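/- All Lie algebras are over $\mathbb{C}$. For a finite-dimensional Lie algebra $\mathfrak g$ and $\varphi\in\mathfrak g^*$ let $B_\varphi(x,y)=\varphi([x,y])$ and $d\varphi(x,y)=-\varphi([x,y])$. The index of $\mathfrak g$ is $\operatorname{ind}\mathfrak g=\min_{\varphi\in\mathfrak g^*}\dim\ker B_\varphi$. The Lie algebra $\mathfrak g$ is called contact if $\dim\mathfrak g=2k+1$ is odd and there is $\varphi\in\mathfrak g^*$ with $\varphi\wedge(d\varphi)^k\neq 0$. For a finite sequence $\underline c=(c_1,\dots,c_r)$ of nonnegative integers with sum $N$, let $X_{\underline c}\subseteq M_N(\mathbb C)$ be the space of block-diagonal matrices with consecutive diagonal blocks of sizes $c_1\times c_1,\dots,c_r\times c_r$, and let $\mathscr L$ and $\mathscr U$ be the spaces of lower and upper triangular matrices in $M_N(\mathbb C)$ (diagonal included). Put $\mathfrak p(\underline c\,|\,\underline d)=(X_{\underline c}\cap\mathscr L)+(X_{\underline d}\cap\mathscr U)$, a Lie subalgebra of $\mathfrak{gl}(N)$. * A type-A seaweed is a Lie algebra $\mathfrak p(\underline a\,|\,\underline b)\cap\mathfrak{sl}(n)$,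 where $\underline a$ and $\underline b$ are compositions of $n$. * A type-C seaweed is a Lie algebra $\mathfrak p(\underline a'\,|\,\underline b')\cap\mathfrak{sp}(2n)$, where $\underline a=(a_1,\dots,a_m)$ and $\underline b=(b_1,\dots,b_t)$ are partial compositions of $n$ (finite, possibly empty, sequences of positive integers with sum at most $n$), $\underline a'=(a_1,\dots,a_m,\,2(n-\sum a_i),\,a_m,\dots,a_1)$, $\underline b'$ is formed from $\underline b$ in the same way, and $\mathfrak{sp}(2n)\subset M_{2n}(\mathbb C)$ is the symplectic Lie algebra of the anti-diagonal form $\omega(e_i,e_{2n+1-i})=1$ for $1\le i\le n$ (and $\omega(e_i,e_j)=0$ if $i+j\ne 2n+1$). **Theorem.** If $\mathfrak g$ is a type-A or a type-C seaweed, then $\mathfrak g$ is contact if and only if $\operatorname{ind}\mathfrak g=1$. -/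

import Mathlib

attribute [local instance 100] LieRing.ofAssociativeRing

namespace Seaweed

noncomputable section

/-! ### One-forms, the index, and contact Lie algebras -/

section LieForms

variable {L : Type*} [LieRing L] [LieAlgebra ℂ L]

/-- The Kirillov form `B_φ(x, y) = φ([x, y])` of a one-form `φ` on a Lie algebra. -/
def kirillovForm (φ : Module.Dual ℂ L) : LinearMap.BilinForm ℂ L :=
  LinearMap.mk₂ ℂ (fun x y => φ ⁅x, y⁆)
    (fun x x' y => by simp) (fun c x y => by simp)
    (fun x y y' => by simp) (fun c x y => by simp)

variable (L) in
/-- The index of a (finite-dimensional) Lie algebra: the minimum over all one-forms `φ` of the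
dimension of the kernel of the Kirillov form `B_φ`. -/
def lieIndex : ℕ :=
  ⨅ φ : Module.Dual ℂ L, Module.finrank ℂ (LinearMap.ker (kirillovForm φ))

/-- A one-form, as an alternating map in one variable. -/
def oneForm (φ : Module.Dual ℂ L) : L [⋀^Fin 1]→ₗ[ℂ] ℂ :=
  AlternatingMap.ofSubsingleton ℂ L ℂ (0 : Fin 1) φ

/-- The exterior derivative of a one-form on a Lie algebra: `dφ(x, y) = -φ([x, y])`. -/
def extDerivOneForm (φ : Module.Dual ℂ L) : L [⋀^Fin 2]→ₗ[ℂ] ℂ where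
  toFun v := - φ ⁅v 0, v 1⁆
  map_update_add' v i x y := by
    fin_cases i <;> simp [Function.update, add_comm]
  map_update_smul' v i c x := by
    fin_cases i <;> simp [Function.update]
  map_eq_zero_of_eq' v i j h hij := by
    have h01 : v 0 = v 1 := by
      fin_cases i <;> fin_cases j <;> simp_all
    simp [h01]

end LieForms

section Wedge

variable {V : Type*} [AddCommGroup V] [Module ℂ V]

/-- The wedge product of scalar-valued alternating forms (the signed sum over shuffles). -/
def wedge {p q : ℕ} (α : V [⋀^Fin p]→ₗ[ℂ] ℂ) (β : V [⋀^Fin q]→ₗ[ℂ] ℂ) :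
    V [⋀^Fin (p + q)]→ₗ[ℂ] ℂ :=
  ((LinearMap.mul' ℂ ℂ).compAlternatingMap (α.domCoprod β)).domDomCongr finSumFinEquiv

/-- The wedge power `ω ∧ ⋯ ∧ ω` (`k` factors) of a two-form `ω`; it is `1` for `k = 0`. -/
def wedgePow (ω : V [⋀^Fin 2]→ₗ[ℂ] ℂ) : (k : ℕ) → V [⋀^Fin (2 * k)]→ₗ[ℂ] ℂ
  | 0 => AlternatingMap.constOfIsEmpty ℂ V (Fin 0) (1 : ℂ)
  | k + 1 => wedge (p := 2 * k) (q := 2) (wedgePow ω k) ω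

end Wedge

/-- A Lie algebra of dimension `2k+1` is contact if it has a one-form `φ` with
`φ ∧ (dφ)^k ≠ 0`. -/
def IsContact (L : Type*) [LieRing L] [LieAlgebra ℂ L] : Prop :=
  ∃ k : ℕ, Module.finrank ℂ L = 2 * k + 1 ∧
    ∃ φ : Module.Dual ℂ L, wedge (oneForm φ) (wedgePow (extDerivOneForm φ) k) ≠ 0

/-! ### Seaweed algebras in standard matrix form -/

/-- Two (zero-based) positions lie in the same block when consecutive blocks of sizes
`c₁, c₂, …` are laid out from position `0`. -/
def SameBlock (c : List ℕ) (i j : ℕ) : Prop :=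
  ∃ k < c.length, ((c.take k).sum ≤ i ∧ i < (c.take (k + 1)).sum) ∧
    ((c.take k).sum ≤ j ∧ j < (c.take (k + 1)).sum)

/-- The block-diagonal `N × N` matrices with diagonal blocks of sizes `c₁, c₂, …`. -/
def blockDiag (N : ℕ) (c : List ℕ) : Submodule ℂ (Matrix (Fin N) (Fin N) ℂ) where
  carrier := {M | ∀ i j : Fin N, ¬ SameBlock c i j → M i j = 0}
  zero_mem' := fun _ _ _ => rfl
  add_mem' := fun hM hM' i j h => by simp [hM i j h, hM' i j h]
  smul_mem' := fun r M hM i j h => by simp [hM i j h]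

/-- The lower triangular `N × N` matrices. -/
def lowerTri (N : ℕ) : Submodule ℂ (Matrix (Fin N) (Fin N) ℂ) where
  carrier := {M | ∀ i j : Fin N, i < j → M i j = 0}
  zero_mem' := fun _ _ _ => rfl
  add_mem' := fun hM hM' i j h => by simp [hM i j h, hM' i j h]
  smul_mem' := fun r M hM i j h => by simp [hM i j h]

/-- The upper triangular `N × N` matrices. -/
def upperTri (N : ℕ) : Submodule ℂ (Matrix (Fin N) (Fin N) ℂ) where
  carrier := {M | ∀ i j : Fin N, j < i → M i j = 0}
  zero_mem' := fun _ _ _ => rfl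
  add_mem' := fun hM hM' i j h => by simp [hM i j h, hM' i j h]
  smul_mem' := fun r M hM i j h => by simp [hM i j h]

/-- The span of the lower triangular part of the block-diagonal matrices of type `a` and the upper
triangular part of the block-diagonal matrices of type `b`. -/
def seaweedSpace (N : ℕ) (a b : List ℕ) : Submodule ℂ (Matrix (Fin N) (Fin N) ℂ) :=
  (blockDiag N a ⊓ lowerTri N) ⊔ (blockDiag N b ⊓ upperTri N)

/-- The location `(i, j)` is one where entries of the seaweed may be nonzero. -/
def Admissible (a b : List ℕ) (i j : ℕ) : Prop :=
  (j ≤ i ∧ SameBlock a i j) ∨ (i ≤ j ∧ SameBlock b i j)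

theorem mem_seaweedSpace {N : ℕ} {a b : List ℕ} {M : Matrix (Fin N) (Fin N) ℂ} :
    M ∈ seaweedSpace N a b ↔ ∀ i j : Fin N, ¬ Admissible a b i j → M i j = 0 := by
  classical
  constructor
  · intro h i j hij
    obtain ⟨A, ⟨hA, hA'⟩, B, ⟨hB, hB'⟩, rfl⟩ := Submodule.mem_sup.1 h
    have h1 : A i j = 0 := by
      by_cases h : i < j
      · exact hA' i j h
      · exact hA i j fun hs => hij (Or.inl ⟨not_lt.1 h, hs⟩)
    have h2 : B i j = 0 := by
      by_cases h : j < i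
      · exact hB' i j h
      · exact hB i j fun hs => hij (Or.inr ⟨not_lt.1 h, hs⟩)
    simp [h1, h2]
  · intro h
    refine Submodule.mem_sup.2
      ⟨Matrix.of fun i j => if j ≤ i ∧ SameBlock a i j then M i j else 0, ⟨?_, ?_⟩,
       Matrix.of fun i j => if j ≤ i ∧ SameBlock a i j then 0 else M i j, ⟨?_, ?_⟩, ?_⟩
    · intro i j hs
      exact if_neg fun h => hs h.2
    · intro i j hs
      exact if_neg fun h => absurd h.1 (not_le.2 hs)
    · intro i j hs
      by_cases hc : j ≤ i ∧ SameBlock a i j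
      · exact if_pos hc
      · refine (if_neg hc).trans (h i j ?_)
        rintro (h' | h')
        · exact hc h'
        · exact hs h'.2
    · intro i j hs
      by_cases hc : j ≤ i ∧ SameBlock a i j
      · exact if_pos hc
      · refine (if_neg hc).trans (h i j ?_)
        rintro (h' | h')
        · exact hc h'
        · exact absurd h'.1 (not_le.2 hs)
    · ext i j
      simp only [Matrix.add_apply, Matrix.of_apply]
      split_ifs <;> simp

theorem Admissible.trans {a b : List ℕ} {i j k : ℕ} (h : Admissible a b i j)
    (h' : Admissible a b j k) : Admissible a b i k := by
  have tr : ∀ {c : List ℕ} {i j k : ℕ}, SameBlock c i j → SameBlock c j k →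
      SameBlock c i k := by
    have key : ∀ {c : List ℕ} {j p q : ℕ}, j < (c.take (p + 1)).sum → (c.take q).sum ≤ j →
        q ≤ p := by
      intro c j p q h1 h2
      by_contra hlt
      have : (c.take (p + 1)).sum ≤ (c.take q).sum :=
        (List.take_sublist_take_left (by omega)).sum_le_sum (by simp)
      omega
    rintro c i j k ⟨p, hp, hi, hj⟩ ⟨q, hq, hj', hk⟩
    have : p = q := le_antisymm (key hj'.2 hj.1) (key hj.2 hj'.1)
    subst this
    exact ⟨p, hp, hi, hk⟩
  have conv : ∀ {c : List ℕ} {x y z : ℕ}, SameBlock c x z →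
      (x ≤ y ∧ y ≤ z ∨ z ≤ y ∧ y ≤ x) → SameBlock c x y ∧ SameBlock c y z := by
    rintro c x y z ⟨p, hp, hx, hz⟩ hy
    exact ⟨⟨p, hp, hx, by omega⟩, ⟨p, hp, by omega, hz⟩⟩
  rcases h with ⟨h1, h2⟩ | ⟨h1, h2⟩ <;> rcases h' with ⟨h3, h4⟩ | ⟨h3, h4⟩
  · exact Or.inl ⟨by omega, tr h2 h4⟩
  · rcases le_total k i with h5 | h5
    · exact Or.inl ⟨h5, (conv h2 (Or.inr ⟨h3, h5⟩)).1⟩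
    · exact Or.inr ⟨h5, (conv h4 (Or.inl ⟨h1, h5⟩)).2⟩
  · rcases le_total k i with h5 | h5
    · exact Or.inl ⟨h5, (conv h4 (Or.inr ⟨h5, h1⟩)).2⟩
    · exact Or.inr ⟨h5, (conv h2 (Or.inl ⟨h5, h3⟩)).1⟩
  · exact Or.inr ⟨by omega, tr h2 h4⟩

theorem mul_mem_seaweedSpace {N : ℕ} {a b : List ℕ} {A B : Matrix (Fin N) (Fin N) ℂ}
    (hA : A ∈ seaweedSpace N a b) (hB : B ∈ seaweedSpace N a b) :
    A * B ∈ seaweedSpace N a b := by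
  rw [mem_seaweedSpace] at *
  intro i k hik
  rw [Matrix.mul_apply]
  refine Finset.sum_eq_zero fun j _ => ?_
  by_cases h : Admissible a b i j
  · rw [hB j k fun h' => hik (h.trans h'), mul_zero]
  · rw [hA i j h, zero_mul]

/-- The seaweed subalgebra of `𝔤𝔩(N)` with lower blocks of sizes `a` and upper blocks of
sizes `b`. -/
def glSeaweed (N : ℕ) (a b : List ℕ) : LieSubalgebra ℂ (Matrix (Fin N) (Fin N) ℂ) where
  toSubmodule := seaweedSpace N a b
  lie_mem' := by
    intro A B hA hB
    rw [Ring.lie_def]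
    exact Submodule.sub_mem _ (mul_mem_seaweedSpace hA hB) (mul_mem_seaweedSpace hB hA)

/-- The type-A seaweed subalgebra of `𝔰𝔩(n)` defined by two compositions of `n`. -/
def typeA {n : ℕ} (a b : Composition n) : LieSubalgebra ℂ (Matrix (Fin n) (Fin n) ℂ) :=
  glSeaweed n a.blocks b.blocks ⊓ LieAlgebra.SpecialLinear.sl (Fin n) ℂ

/-- A partial composition of `n`: a finite, possibly empty, list of positive integers with sum at
most `n`. -/
structure PartialComposition (n : ℕ) where
  blocks : List ℕ
  blocks_pos : ∀ x ∈ blocks, 0 < x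
  sum_le : blocks.sum ≤ n

/-- The palindromic list of block sizes `a₁, …, a_m, 2(n - ∑ a_i), a_m, …, a₁`. -/
def PartialComposition.double {n : ℕ} (a : PartialComposition n) : List ℕ :=
  a.blocks ++ [2 * (n - a.blocks.sum)] ++ a.blocks.reverse

/-- The matrix of the symplectic form on `ℂ^{2n}` supported on the anti-diagonal, with entries `1`
in the first `n` rows and `-1` in the last `n` rows. -/
def antiJ (n : ℕ) : Matrix (Fin (2 * n)) (Fin (2 * n)) ℂ :=
  fun i j => if j = i.rev then (if (i : ℕ) < n then 1 else -1) else 0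

/-- `𝔰𝔭(2n)`, realized as the matrices that are skew-adjoint for the anti-diagonal symplectic
form. -/
def sp (n : ℕ) : LieSubalgebra ℂ (Matrix (Fin (2 * n)) (Fin (2 * n)) ℂ) :=
  skewAdjointMatricesLieSubalgebra (antiJ n)

/-- The type-C seaweed subalgebra of `𝔰𝔭(2n)` defined by two partial compositions of `n`. -/
def typeC {n : ℕ} (a b : PartialComposition n) :
    LieSubalgebra ℂ (Matrix (Fin (2 * n)) (Fin (2 * n)) ℂ) :=
  glSeaweed (2 * n) a.double b.double ⊓ sp n

end

end Seaweed

/-! A one-form `φ` on an odd-dimensional algebra is contact exactly when the radical of `B_φ` is a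
line on which `φ` does not vanish. Since `B_φ` has even rank, contact implies index 1.

For the converse, let the index be 1 and suppose that no contact form exists. Let the radical of `φ`
be the line through `x`. If `x ∉ [x, g]`, choose `χ` vanishing on `[x, g]` with `χ(x) ≠ 0`; then `χ
+ tφ` is contact for almost every `t`. Hence `x = [x, y]` for some `y`, which makes the matrix `x`
nilpotent. Now let `φ₁` be arbitrary. For all but finitely many `t` the radical of `φ₁ + tφ` is a
line, spanned by a nilpotent matrix of norm 1. Letting `t → 0`, compactness produces a nonzero
nilpotent in the radical of `φ₁`. So it is enough to exhibit one `φ₁` whose radical contains no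
nonzero nilpotent (`isContact_of_lieIndex_eq_one`).

For seaweeds take `φ₁(y) = tr (F y)`, with `F` built by induction along Panyushev's reduction. Equal
first blocks split off a full matrix algebra, where a diagonal `F` with distinct entries works
(`NilFree.add_block`). Unequal ones reduce to a smaller seaweed by `NilFree.pair_block` or
`NilFree.shift_block`, according to whether the shorter block is at most half of the longer. The
induction runs on palindromic seaweeds in `gl(2n)`, with both ends reduced together so that `F`
stays in `sp(2n)` (`hasSkewForm`). Type C follows because a skew commutator is detected by `sp(2n)`.
Type A follows by restricting to the upper left corner of a palindromic seaweed with empty central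
block. -/

namespace Seaweed

open Module

/-! ### Evaluating wedge products and powers of a two-form -/

section WedgeEvaluation

variable {V : Type*} [AddCommGroup V] [Module ℂ V]

/-- The contribution of a coset of permutations to the value of a wedge product. -/
noncomputable def wedgeTerm {p q : ℕ} (α : V [⋀^Fin p]→ₗ[ℂ] ℂ) (β : V [⋀^Fin q]→ₗ[ℂ] ℂ)
    (v : Fin (p + q) → V) (s : Equiv.Perm.ModSumCongr (Fin p) (Fin q)) : ℂ :=
  LinearMap.mul' ℂ ℂ (AlternatingMap.domCoprod.summand α β s (v ∘ finSumFinEquiv))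

theorem wedge_apply {p q : ℕ} (α : V [⋀^Fin p]→ₗ[ℂ] ℂ) (β : V [⋀^Fin q]→ₗ[ℂ] ℂ)
    (v : Fin (p + q) → V) : wedge α β v = ∑ s, wedgeTerm α β v s := by
  simp only [wedge, wedgeTerm, AlternatingMap.domDomCongr_apply, LinearMap.compAlternatingMap_apply,
    AlternatingMap.domCoprod_apply, sum_apply, map_sum]

theorem wedgeTerm_mk {p q : ℕ} (α : V [⋀^Fin p]→ₗ[ℂ] ℂ) (β : V [⋀^Fin q]→ₗ[ℂ] ℂ)
    (v : Fin (p + q) → V) (σ : Equiv.Perm (Fin p ⊕ Fin q)) :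
    wedgeTerm α β v (QuotientGroup.mk σ) = Equiv.Perm.sign σ •
      (α (fun i => v (finSumFinEquiv (σ (Sum.inl i)))) *
        β (fun i => v (finSumFinEquiv (σ (Sum.inr i))))) := by
  change LinearMap.mul' ℂ ℂ (AlternatingMap.domCoprod.summand α β (Quotient.mk'' σ) _) = _
  rw [AlternatingMap.domCoprod.summand_mk'']
  simp only [smul_apply, MultilinearMap.domDomCongr_apply, MultilinearMap.domCoprod_apply]
  rcases Int.units_eq_one_or (Equiv.Perm.sign σ) with h | h <;>
    simp [h]

theorem wedge_eq_zero_of_mem {p q : ℕ} {α : V [⋀^Fin p]→ₗ[ℂ] ℂ} {β : V [⋀^Fin q]→ₗ[ℂ] ℂ} {x : V}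
    (hα : ∀ v i, v i = x → α v = 0) (hβ : ∀ v i, v i = x → β v = 0)
    (v : Fin (p + q) → V) (i : Fin (p + q)) (hi : v i = x) : wedge α β v = 0 := by
  rw [wedge_apply]
  refine Finset.sum_eq_zero fun s _ => ?_
  induction s using QuotientGroup.induction_on with
  | H σ =>
    rw [wedgeTerm_mk]
    have key : finSumFinEquiv (σ (σ.symm (finSumFinEquiv.symm i))) = i := by simp
    rcases h : σ.symm (finSumFinEquiv.symm i) with j | j
    · rw [hα _ j (by rw [← h, key, hi]), zero_mul, smul_zero]
    · rw [hβ _ j (by rw [← h, key, hi]), mul_zero, smul_zero]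

/-- No cancellation can occur: the sum is `c` times the number of nonzero terms, and that number is
nonzero in characteristic zero. -/
theorem wedge_ne_zero_of_terms {p q : ℕ} {α : V [⋀^Fin p]→ₗ[ℂ] ℂ} {β : V [⋀^Fin q]→ₗ[ℂ] ℂ}
    {v : Fin (p + q) → V} {c : ℂ} (hc : c ≠ 0)
    (h : ∀ s, wedgeTerm α β v s = 0 ∨ wedgeTerm α β v s = c)
    (h1 : ∃ s, wedgeTerm α β v s = c) : wedge α β v ≠ 0 := by
  classical
  obtain ⟨s, hs⟩ := h1
  have : ∀ s, wedgeTerm α β v s = if wedgeTerm α β v s = c then c else 0 := by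
    intro s
    split_ifs with h'
    · exact h'
    · exact (h s).resolve_right h'
  rw [wedge_apply, Finset.sum_congr rfl fun s _ => this s, ← Finset.sum_filter, Finset.sum_const,
    nsmul_eq_mul]
  refine mul_ne_zero (Nat.cast_ne_zero.2 (Finset.card_ne_zero.2 ⟨s, ?_⟩)) hc
  simpa using hs

theorem wedgePow_eq_zero_of_mem {ω : V [⋀^Fin 2]→ₗ[ℂ] ℂ} {x : V}
    (h : ∀ v i, v i = x → ω v = 0) (k : ℕ) (v : Fin (2 * k) → V) (i : Fin (2 * k))
    (hi : v i = x) : wedgePow ω k v = 0 := by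
  induction k with
  | zero => exact i.elim0
  | succ k ih => exact wedge_eq_zero_of_mem ih h v i hi

/-- The expansion of a wedge power involves the vectors only through the numbers `ω ![v i, v j]`.
This is what allows hyperbolic pairs to be permuted freely. -/
theorem wedgePow_congr_gram {ω : V [⋀^Fin 2]→ₗ[ℂ] ℂ} {k : ℕ} {v w : Fin (2 * k) → V}
    (h : ∀ i j, ω ![v i, v j] = ω ![w i, w j]) : wedgePow ω k v = wedgePow ω k w := by
  induction k with
  | zero => exact congrArg _ (funext fun i => i.elim0)
  | succ k ih =>
    change wedge (wedgePow ω k) ω v = wedge (wedgePow ω k) ω w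
    rw [wedge_apply, wedge_apply]
    refine Finset.sum_congr rfl fun s _ => ?_
    induction s using QuotientGroup.induction_on with
    | H σ =>
      rw [wedgeTerm_mk, wedgeTerm_mk, ih fun i j => h _ _]
      have e : ∀ u : Fin 2 → V, u = ![u 0, u 1] := fun u => by
        ext i; fin_cases i <;> rfl
      rw [e fun i => v (finSumFinEquiv (σ (Sum.inr i))),
        e fun i => w (finSumFinEquiv (σ (Sum.inr i))), h]

/-- The Gram matrix of a standard symplectic basis `e₀, f₀, e₁, f₁, …`. -/
def symplecticGram (i j : ℕ) : ℂ :=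
  if j = i + 1 ∧ i % 2 = 0 then 1 else if i = j + 1 ∧ j % 2 = 0 then -1 else 0

/-- A shuffle contributes only if it puts a hyperbolic pair into the last two slots. Exchanging
whole pairs is an even permutation preserving the Gram matrix, so all contributions are equal to the
value of the lower power on the first `2 * k` vectors. -/
theorem wedgePow_ne_zero {ω : V [⋀^Fin 2]→ₗ[ℂ] ℂ} {k : ℕ} {v : Fin (2 * k) → V}
    (h : ∀ i j, ω ![v i, v j] = symplecticGram i j) : wedgePow ω k v ≠ 0 := by
  induction k with
  | zero => simp [wedgePow]
  | succ k ih =>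
    have e : ∀ u : Fin 2 → V, u = ![u 0, u 1] := fun u => by
      ext i; fin_cases i <;> rfl
    set v₀ : Fin (2 * k) → V := fun i => v (finSumFinEquiv (Sum.inl i)) with hv₀
    have hg₀ : ∀ i j, ω ![v₀ i, v₀ j] = symplecticGram i j := fun i j => by
      rw [hv₀, h]; simp
    have hone : ∀ ρ : Equiv.Perm (Fin (2 * k) ⊕ Fin 2), Equiv.Perm.sign ρ = 1 →
        (∀ x y, symplecticGram (finSumFinEquiv (ρ x) : Fin (2 * k + 2))
          (finSumFinEquiv (ρ y) : Fin (2 * k + 2)) =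
          symplecticGram (finSumFinEquiv x : Fin (2 * k + 2))
            (finSumFinEquiv y : Fin (2 * k + 2))) →
        wedgeTerm (wedgePow ω k) ω v (QuotientGroup.mk ρ) = wedgePow ω k v₀ := by
      intro ρ hs hρ
      rw [wedgeTerm_mk, hs, one_smul, e fun i => v (finSumFinEquiv (ρ (Sum.inr i))), h]
      have h1 := hρ (Sum.inr 0) (Sum.inr 1)
      rw [h1, wedgePow_congr_gram (w := v₀)]
      · simp [symplecticGram]
      · intro i j
        rw [h, hg₀]
        have := hρ (Sum.inl i) (Sum.inl j)
        simpa using this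
    refine wedge_ne_zero_of_terms (ih hg₀) (fun s => ?_)
      ⟨QuotientGroup.mk 1, hone 1 (by simp) (fun _ _ => rfl)⟩
    induction s using QuotientGroup.induction_on with
    | H σ =>
      by_cases hp : symplecticGram (finSumFinEquiv (σ (Sum.inr 0)) : Fin (2 * k + 2))
          (finSumFinEquiv (σ (Sum.inr 1)) : Fin (2 * k + 2)) = 0
      · left
        rw [wedgeTerm_mk, e fun i => v (finSumFinEquiv (σ (Sum.inr i))), h, hp]
        simp
      · right
        -- an even permutation moving the pair at the end to where `σ` sends it
        obtain ⟨ρ, hs, hg, hr⟩ : ∃ ρ : Equiv.Perm (Fin (2 * k) ⊕ Fin 2), Equiv.Perm.sign ρ = 1 ∧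
            (∀ x y, symplecticGram (finSumFinEquiv (ρ x) : Fin (2 * k + 2))
              (finSumFinEquiv (ρ y) : Fin (2 * k + 2)) =
              symplecticGram (finSumFinEquiv x : Fin (2 * k + 2))
                (finSumFinEquiv y : Fin (2 * k + 2))) ∧
            ∀ i, ∃ j, ρ (Sum.inr j) = σ (Sum.inr i) := by
          set A : ℕ := (finSumFinEquiv (σ (Sum.inr 0)) : Fin (2 * k + 2)).val with hA
          set B : ℕ := (finSumFinEquiv (σ (Sum.inr 1)) : Fin (2 * k + 2)).val with hB
          obtain ⟨a, ha, hAB⟩ : ∃ a, a % 2 = 0 ∧ ((A = a ∧ B = a + 1) ∨ (A = a + 1 ∧ B = a)) := by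
            unfold symplecticGram at hp
            split_ifs at hp with h1 h2
            · exact ⟨A, h1.2, Or.inl ⟨rfl, h1.1⟩⟩
            · exact ⟨B, h2.2, Or.inr ⟨h2.1, rfl⟩⟩
            · exact absurd rfl hp
          have hAlt : A < 2 * k + 2 := Fin.isLt _
          have hBlt : B < 2 * k + 2 := Fin.isLt _
          have hinj : ∀ x y : Fin (2 * k) ⊕ Fin 2, (finSumFinEquiv x : Fin (2 * k + 2)).val =
              (finSumFinEquiv y : Fin (2 * k + 2)).val → x = y := fun x y hxy =>
            finSumFinEquiv.injective (Fin.ext hxy)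
          by_cases hak : a < 2 * k
          · obtain ⟨ρ, hs, hval⟩ : ∃ ρ : Equiv.Perm (Fin (2 * k) ⊕ Fin 2),
                Equiv.Perm.sign ρ = 1 ∧
                ∀ x, (finSumFinEquiv (ρ x) : Fin (2 * k + 2)).val =
                  if (finSumFinEquiv x : Fin (2 * k + 2)).val = a then 2 * k
                  else if (finSumFinEquiv x : Fin (2 * k + 2)).val = a + 1 then 2 * k + 1
                  else if (finSumFinEquiv x : Fin (2 * k + 2)).val = 2 * k then a
                  else if (finSumFinEquiv x : Fin (2 * k + 2)).val = 2 * k + 1 then a + 1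
                  else (finSumFinEquiv x : Fin (2 * k + 2)).val := by
              -- Exchanges the pair `a, a + 1` with the last pair; being two transpositions, it is
              -- even.
              refine ⟨Equiv.swap (Sum.inl ⟨a, hak⟩) (Sum.inr 0) *
                Equiv.swap (Sum.inl ⟨a + 1, by omega⟩) (Sum.inr 1), ?_, ?_⟩
              · rw [Equiv.Perm.sign_mul, Equiv.Perm.sign_swap (by simp),
                  Equiv.Perm.sign_swap (by simp)]
                rfl
              · rintro (i | j)
                · have hi := i.2
                  simp only [Equiv.Perm.mul_apply, Equiv.swap_apply_def, Sum.inl.injEq, Fin.ext_iff,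
                    reduceCtorEq, if_false, finSumFinEquiv_apply_left, Fin.val_castAdd]
                  by_cases h1 : i.val = a
                  · simp [h1, Fin.ext_iff]
                  · by_cases h2 : i.val = a + 1
                    · simp [h2]
                    · simp [h1, h2, Fin.ext_iff, show i.val ≠ 2 * k by omega,
                        show i.val ≠ 2 * k + 1 by omega]
                · fin_cases j
                  · simp [Equiv.swap_apply_def]
                    split_ifs <;> omega
                  · simp [Equiv.swap_apply_def]
                    split_ifs <;> omega
            refine ⟨ρ, hs, fun x y => ?_, fun i => ?_⟩
            · rw [hval, hval]
              have hx := (finSumFinEquiv x : Fin (2 * k + 2)).isLt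
              have hy := (finSumFinEquiv y : Fin (2 * k + 2)).isLt
              generalize (finSumFinEquiv x : Fin (2 * k + 2)).val = X at *
              generalize (finSumFinEquiv y : Fin (2 * k + 2)).val = Y at *
              unfold symplecticGram
              congr 1
              · rw [eq_iff_iff]
                split_ifs <;> omega
              · congr 1
                rw [eq_iff_iff]
                split_ifs <;> omega
            · have h0 : (finSumFinEquiv (ρ (Sum.inr 0)) : Fin (2 * k + 2)).val = a := by
                rw [hval]; simp; split_ifs <;> omega
              have h1 : (finSumFinEquiv (ρ (Sum.inr 1)) : Fin (2 * k + 2)).val = a + 1 := by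
                rw [hval]; simp; split_ifs <;> omega
              rcases hAB with ⟨h2, h3⟩ | ⟨h2, h3⟩ <;> fin_cases i
              · exact ⟨0, hinj _ _ (h0.trans h2.symm)⟩
              · exact ⟨1, hinj _ _ (h1.trans h3.symm)⟩
              · exact ⟨1, hinj _ _ (h1.trans h2.symm)⟩
              · exact ⟨0, hinj _ _ (h0.trans h3.symm)⟩
          · refine ⟨1, by simp, fun _ _ => rfl, fun i => ?_⟩
            have h0 : (finSumFinEquiv (Sum.inr 0 : Fin (2 * k) ⊕ Fin 2)).val = 2 * k := by simp
            have h1 : (finSumFinEquiv (Sum.inr 1 : Fin (2 * k) ⊕ Fin 2)).val = 2 * k + 1 := by simp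
            rcases hAB with ⟨h2, h3⟩ | ⟨h2, h3⟩ <;> fin_cases i
            · exact ⟨0, hinj _ _ (h0.trans (by change _ = A; omega))⟩
            · exact ⟨1, hinj _ _ (h1.trans (by change _ = B; omega))⟩
            · exact ⟨1, hinj _ _ (h1.trans (by change _ = A; omega))⟩
            · exact ⟨0, hinj _ _ (h0.trans (by change _ = B; omega))⟩
        -- `ρ⁻¹ * σ` preserves the last two slots, so `ρ` and `σ` represent the same shuffle.
        have hmem : ρ⁻¹ * σ ∈ (Equiv.Perm.sumCongrHom (Fin (2 * k)) (Fin 2)).range := by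
          refine Equiv.Perm.mem_sumCongrHom_range_of_perm_mapsTo_inl ?_
          choose f hf using hr
          have hf' : ∀ i, (ρ⁻¹ * σ) (Sum.inr i) = Sum.inr (f i) := fun i => by
            rw [Equiv.Perm.mul_apply, ← hf]; exact ρ.symm_apply_apply _
          have hfi : Function.Injective f := fun i j hij => by
            have := (hf' i).trans ((congrArg Sum.inr hij).trans (hf' j).symm)
            simpa using this
          rintro _ ⟨i, rfl⟩
          rcases hx : (ρ⁻¹ * σ) (Sum.inl i) with j | j
          · exact ⟨j, rfl⟩
          · obtain ⟨i', rfl⟩ := (Finite.injective_iff_surjective.1 hfi) j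
            have := (ρ⁻¹ * σ).injective (hx.trans (hf' i').symm)
            simp at this
        rw [← hone ρ hs hg]
        congr 1
        exact (QuotientGroup.eq.2 hmem).symm

end WedgeEvaluation

/-! ### Alternating forms and pencils of linear maps -/

section SymplecticFamilies

/-- Split off a hyperbolic plane spanned by `e, f`; its orthogonal complement `W` has the same
radical as the whole space. Besides the family, this yields the parity of the radical on which the
index arguments rest. -/
theorem exists_symplectic_family (m : ℕ) : ∀ {V : Type*} [AddCommGroup V] [Module ℂ V]
    [FiniteDimensional ℂ V] (B : LinearMap.BilinForm ℂ V) (_ : ∀ x, B x x = 0)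
    (_ : finrank ℂ V = m), ∃ (k : ℕ) (v : Fin (2 * k) → V),
      (∀ i j, B (v i) (v j) = symplecticGram i j) ∧
      finrank ℂ V = 2 * k + finrank ℂ (LinearMap.ker B) := by
  induction m using Nat.strong_induction_on with
  | _ m ih =>
    intro V _ _ _ B hB hm
    have hskew : ∀ x y, B x y = - B y x := fun x y => by
      have := hB (x + y)
      simp only [map_add, LinearMap.add_apply, hB, zero_add, add_zero] at this
      linear_combination this
    by_cases h0 : B = 0
    · refine ⟨0, fun i => i.elim0, fun i => i.elim0, ?_⟩
      rw [h0, LinearMap.ker_zero, finrank_top]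
      omega
    · obtain ⟨e, f, hef⟩ : ∃ e f, B e f = 1 := by
        obtain ⟨e, he⟩ := not_forall.1 fun h => h0 (LinearMap.ext h)
        obtain ⟨f, hf⟩ := not_forall.1 fun h => he (LinearMap.ext h)
        refine ⟨e, (B e f)⁻¹ • f, ?_⟩
        rw [map_smul, smul_eq_mul, inv_mul_cancel₀ hf]
      have hfe : B f e = -1 := by rw [hskew, hef]
      set W : Submodule ℂ V := LinearMap.ker ((B e).prod (B f)) with hW
      have hmemW : ∀ {y}, y ∈ W ↔ B e y = 0 ∧ B f y = 0 := fun {y} => by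
        simp [hW, LinearMap.mem_ker]
      have hsurj : Function.Surjective ((B e).prod (B f)) := by
        rintro ⟨a, b⟩
        refine ⟨a • f - b • e, ?_⟩
        simp [hB, hef, hfe]
      have hdim : finrank ℂ W + 2 = finrank ℂ V := by
        have := LinearMap.finrank_range_add_finrank_ker ((B e).prod (B f))
        rw [LinearMap.range_eq_top.2 hsurj, finrank_top, finrank_prod, finrank_self, ← hW] at this
        omega
      obtain ⟨k, w, hw, hk⟩ := ih (finrank ℂ W) (by omega) (B.restrict W) (fun x => hB x) rfl
      have hker : Submodule.map W.subtype (LinearMap.ker (B.restrict W)) = LinearMap.ker B := by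
        ext x
        simp only [Submodule.mem_map, LinearMap.mem_ker]
        constructor
        · rintro ⟨⟨x, hx⟩, h, rfl⟩
          ext y
          have hy : y - (B e y) • f + (B f y) • e ∈ W := by
            rw [hmemW]; simp [hB, hef, hfe]
          have h1 := LinearMap.congr_fun h ⟨_, hy⟩
          change B x (y - (B e y) • f + (B f y) • e) = 0 at h1
          obtain ⟨h2, h3⟩ := hmemW.1 hx
          rw [hskew] at h2 h3
          rw [neg_eq_zero] at h2 h3
          simpa [h2, h3] using h1
        · intro h
          have hx : x ∈ W := hmemW.2 ⟨by rw [hskew, h]; simp, by rw [hskew, h]; simp⟩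
          exact ⟨⟨x, hx⟩, LinearMap.ext fun y => LinearMap.congr_fun h y, rfl⟩
      refine ⟨k + 1, fun i => if h : (i : ℕ) < 2 * k then (w ⟨i, h⟩ : V) else
        if (i : ℕ) = 2 * k then e else f, ?_, ?_⟩
      · have hwe : ∀ i, B e (w i) = 0 ∧ B f (w i) = 0 := fun i => hmemW.1 (w i).2
        have hwe' : ∀ i, B (w i) e = 0 ∧ B (w i) f = 0 := fun i => by
          rw [hskew, hskew (w i) f, (hwe i).1, (hwe i).2]; simp
        intro i j
        have hi := i.2
        have hj := j.2
        simp only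
        split_ifs with h1 h2 h3 h4 h5 h6 h7 h8
        · exact hw _ _
        all_goals simp only [hwe, hwe', hB, hef, hfe]
        all_goals
          unfold symplecticGram
          split_ifs <;> first | rfl | omega
      · have := Submodule.finrank_map_subtype_eq W (LinearMap.ker (B.restrict W))
        rw [hker] at this
        omega

/-- Compressing `A + t • C` to the range of `C`, by a retraction `π` and a section `s`, gives `π ∘ A
∘ s + t`, which is invertible unless `-t` is an eigenvalue of `π ∘ A ∘ s`. Outside that finite set
the rank is at least that of `C`. -/
theorem exists_smul_add_finrank_ker_le {V U : Type*} [AddCommGroup V] [Module ℂ V]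
    [FiniteDimensional ℂ V] [AddCommGroup U] [Module ℂ U] (A C : V →ₗ[ℂ] U) :
    {t : ℂ | ¬ finrank ℂ (LinearMap.ker (A + t • C)) ≤ finrank ℂ (LinearMap.ker C)}.Finite := by
  obtain ⟨π, hπ⟩ := (LinearMap.range C).subtype.exists_leftInverse_of_injective
    (Submodule.ker_subtype _)
  obtain ⟨s, hs⟩ := C.rangeRestrict.exists_rightInverse_of_surjective
    (LinearMap.range_rangeRestrict C)
  refine ((Module.End.finite_hasEigenvalue (π ∘ₗ A ∘ₗ s)).preimage
    (f := fun t : ℂ => -t) neg_injective.injOn).subset fun t ht => ?_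
  by_contra hne
  apply ht
  have hC : ∀ x, π (C x) = C.rangeRestrict x := fun x =>
    LinearMap.congr_fun hπ (C.rangeRestrict x)
  have hcomp : ∀ y, π ((A + t • C) (s y)) = (π ∘ₗ A ∘ₗ s) y + t • y := fun y => by
    simp only [LinearMap.add_apply, LinearMap.smul_apply, map_add, map_smul, hC,
      LinearMap.comp_apply]
    rw [show C.rangeRestrict (s y) = y from LinearMap.congr_fun hs y]
  have hinj : Function.Injective (π ∘ₗ (A + t • C) ∘ₗ s) := by
    rw [injective_iff_map_eq_zero]
    intro y hy
    by_contra hy0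
    refine hne (Module.End.hasEigenvalue_of_hasEigenvector (x := y) ⟨?_, hy0⟩)
    rw [Module.End.mem_eigenspace_iff]
    have := (hcomp y).symm.trans hy
    rw [neg_smul]
    exact eq_neg_of_add_eq_zero_left this
  have hsurj : Function.Surjective (π ∘ₗ (A + t • C)) := by
    have := LinearMap.injective_iff_surjective.1 hinj
    exact fun y => (this y).imp' s fun x hx => hx
  have h1 := LinearMap.finrank_range_add_finrank_ker (π ∘ₗ (A + t • C))
  have h2 := LinearMap.finrank_range_add_finrank_ker C
  rw [LinearMap.range_eq_top.2 hsurj, finrank_top] at h1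
  have h3 : finrank ℂ (LinearMap.ker (A + t • C)) ≤
      finrank ℂ (LinearMap.ker (π ∘ₗ (A + t • C))) :=
    Submodule.finrank_mono (LinearMap.ker_le_ker_comp _ _)
  omega

end SymplecticFamilies

/-! ### Contact forms in terms of the radical -/

section ContactCriterion

variable {L : Type*} [LieRing L] [LieAlgebra ℂ L]

theorem mem_ker_kirillovForm {φ : Dual ℂ L} {x : L} :
    x ∈ LinearMap.ker (kirillovForm φ) ↔ ∀ y, φ ⁅x, y⁆ = 0 := by
  rw [LinearMap.mem_ker, LinearMap.ext_iff]
  rfl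

variable [FiniteDimensional ℂ L]

theorem exists_finrank_eq_two_mul_add (φ : Dual ℂ L) : ∃ (k : ℕ) (v : Fin (2 * k) → L),
    (∀ i j, φ ⁅v i, v j⁆ = symplecticGram i j) ∧
      finrank ℂ L = 2 * k + finrank ℂ (LinearMap.ker (kirillovForm φ)) :=
  exists_symplectic_family _ (kirillovForm φ) (fun x => by simp [kirillovForm]) rfl

/-- A nonzero such `x` annihilates both `φ` and `dφ`, hence every term of the wedge product in which
it appears. Completed to a basis, it appears whenever the top form is evaluated on distinct basis
vectors. -/
theorem eq_zero_of_wedge_ne_zero {k : ℕ} (hk : finrank ℂ L = 2 * k + 1) {φ : Dual ℂ L}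
    (h : wedge (oneForm φ) (wedgePow (extDerivOneForm φ) k) ≠ 0) {x : L}
    (hx : x ∈ LinearMap.ker (kirillovForm φ)) (hφ : φ x = 0) : x = 0 := by
  by_contra hx0
  rw [mem_ker_kirillovForm] at hx
  have hli : LinearIndepOn ℂ id ({x} : Set L) := LinearIndepOn.singleton hx0
  set b := Basis.extend hli
  have hbx : ∃ i, b i = x := by
    refine ⟨⟨x, hli.subset_extend _ rfl⟩, ?_⟩
    simp [b, Basis.extend_apply_self]
  have : Fintype (hli.extend (Set.subset_univ _)) := FiniteDimensional.fintypeBasisIndex b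
  refine h (Basis.ext_alternating b fun v hv => ?_)
  have hbij : Function.Bijective v := by
    rw [Fintype.bijective_iff_injective_and_card]
    refine ⟨hv, ?_⟩
    rw [← finrank_eq_card_basis b, hk, Fintype.card_fin, add_comm]
  obtain ⟨j, hj⟩ := hbx
  obtain ⟨i, rfl⟩ := hbij.2 j
  refine (wedge_eq_zero_of_mem (x := x) ?_ (wedgePow_eq_zero_of_mem ?_ k) _ i hj).trans rfl
  · intro w i hi
    obtain rfl : i = 0 := Subsingleton.elim _ _
    simp [oneForm, hi, hφ]
  · intro w i hi
    change - φ ⁅w 0, w 1⁆ = 0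
    fin_cases i
    · rw [show w 0 = x from hi, hx, neg_zero]
    · rw [show w 1 = x from hi, ← lie_skew, map_neg, hx, neg_zero, neg_zero]

/-- Odd dimension forces every radical to be nonzero, because `B_ψ` has even rank; the contact form
is injective on its own radical, which is therefore at most a line. -/
theorem IsContact.lieIndex_eq_one (h : IsContact L) : lieIndex L = 1 := by
  obtain ⟨k, hk, φ, hφ⟩ := h
  have h1 : ∀ ψ : Dual ℂ L, 1 ≤ finrank ℂ (LinearMap.ker (kirillovForm ψ)) := fun ψ => by
    obtain ⟨m, -, -, hm⟩ := exists_finrank_eq_two_mul_add ψ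
    omega
  have h2 : finrank ℂ (LinearMap.ker (kirillovForm φ)) ≤ 1 := by
    have hinj : Function.Injective (φ ∘ₗ (LinearMap.ker (kirillovForm φ)).subtype) := by
      rw [injective_iff_map_eq_zero]
      exact fun x hx => Subtype.ext (eq_zero_of_wedge_ne_zero hk hφ x.2 hx)
    simpa using LinearMap.finrank_le_finrank_of_injective hinj
  exact le_antisymm ((ciInf_le (OrderBot.bddBelow _) φ).trans h2) (le_ciInf h1)

/-- Evaluate on `x` followed by a symplectic family for `dφ`. A term with `x` in a slot of `dφ`
vanishes, so only the trivial shuffle survives, with value `φ x` times a nonzero power. -/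
theorem isContact_of_ker_kirillovForm {φ : Dual ℂ L}
    (h : finrank ℂ (LinearMap.ker (kirillovForm φ)) = 1) {x : L}
    (hx : x ∈ LinearMap.ker (kirillovForm φ)) (hφ : φ x ≠ 0) : IsContact L := by
  obtain ⟨k, v, hv, hk⟩ := exists_finrank_eq_two_mul_add φ
  rw [h] at hk
  rw [mem_ker_kirillovForm] at hx
  have hx' : ∀ y, φ ⁅y, x⁆ = 0 := fun y => by rw [← lie_skew, map_neg, hx, neg_zero]
  refine ⟨k, hk, φ, fun h0 => ?_⟩
  -- the second half of every pair is negated, as `dφ = -B_φ`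
  set w : Fin (2 * k) → L := fun i => if i.val % 2 = 0 then v i else - v i with hw
  have hgram : ∀ i j, extDerivOneForm φ ![w i, w j] = symplecticGram i j := by
    intro i j
    change - φ ⁅w i, w j⁆ = _
    have := hv i j
    simp only [hw]
    split_ifs with h1 h2 h2 <;> simp only [neg_lie, lie_neg, map_neg, this] <;>
      unfold symplecticGram <;> split_ifs <;> first | omega | simp
  set u : Fin (1 + 2 * k) → L := fun i => Sum.elim (fun _ => x) w (finSumFinEquiv.symm i) with hu
  have huv : ∀ s, u (finSumFinEquiv s) = Sum.elim (fun _ => x) w s := fun s => by simp [hu]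
  refine wedge_ne_zero_of_terms (v := u) (mul_ne_zero hφ (wedgePow_ne_zero hgram)) (fun s => ?_)
    ⟨QuotientGroup.mk 1, ?_⟩ (by rw [h0]; rfl)
  · induction s using QuotientGroup.induction_on with
    | H σ =>
      rcases hσ : σ (Sum.inl 0) with j | j
      · right
        have hmem : (1 : Equiv.Perm (Fin 1 ⊕ Fin (2 * k)))⁻¹ * σ ∈
            (Equiv.Perm.sumCongrHom (Fin 1) (Fin (2 * k))).range := by
          refine Equiv.Perm.mem_sumCongrHom_range_of_perm_mapsTo_inl ?_
          rintro _ ⟨i, rfl⟩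
          obtain rfl : i = 0 := Subsingleton.elim _ _
          simp [hσ]
        rw [← QuotientGroup.eq.2 hmem, wedgeTerm_mk]
        simp only [huv]
        simp [oneForm]
      · left
        obtain ⟨i, hi⟩ := σ.surjective (Sum.inl 0)
        rcases i with i | i
        · obtain rfl : i = 0 := Subsingleton.elim _ _
          rw [hi] at hσ
          cases hσ
        · rw [wedgeTerm_mk, wedgePow_eq_zero_of_mem (x := x) _ k _ i]
          · simp
          · rw [hi, huv]; rfl
          · intro z l hl
            change - φ ⁅z 0, z 1⁆ = 0
            fin_cases l
            · rw [show z 0 = x from hl, hx, neg_zero]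
            · rw [show z 1 = x from hl, hx', neg_zero]
  · rw [wedgeTerm_mk]
    simp only [huv]
    simp [oneForm]

end ContactCriterion

/-! ### Non-contact algebras of index one have nilpotent radicals -/

section IndexOne

/-- Every nonzero power `x ^ k` is an eigenvector of `a ↦ a * y - y * a` with eigenvalue `k`, and
only finitely many eigenvalues are available. -/
theorem isNilpotent_of_commutator_eq {A : Type*} [Ring A] [Algebra ℂ A] [FiniteDimensional ℂ A]
    {x y : A} (h : x * y - y * x = x) : IsNilpotent x := by
  by_contra hx
  have hpow : ∀ k : ℕ, x ^ k * y - y * x ^ k = (k : ℂ) • x ^ k := by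
    intro k
    induction k with
    | zero => simp
    | succ k ih =>
      have : x ^ (k + 1) * y - y * x ^ (k + 1) =
          x ^ k * (x * y - y * x) + (x ^ k * y - y * x ^ k) * x := by noncomm_ring
      rw [this, h, ih, smul_mul_assoc, ← pow_succ, Nat.cast_succ, add_smul, one_smul, add_comm]
  refine Set.infinite_of_injective_forall_mem (f := fun k : ℕ => (k : ℂ)) Nat.cast_injective
    (fun k => ?_) (Module.End.finite_hasEigenvalue
      (LinearMap.mulRight ℂ y - LinearMap.mulLeft ℂ y))
  refine Module.End.hasEigenvalue_of_hasEigenvector (x := x ^ k) ⟨?_, fun h0 => hx ⟨k, h0⟩⟩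
  rw [Module.End.mem_eigenspace_iff]
  exact hpow k

/-- Cayley–Hamilton gives an exponent depending only on the size, which makes nilpotency a closed
condition; the limit argument needs this. -/
theorem pow_card_eq_zero_of_isNilpotent {N : ℕ} {x : Matrix (Fin N) (Fin N) ℂ}
    (h : IsNilpotent x) : x ^ N = 0 := by
  have h1 := (Matrix.isNilpotent_charpoly_sub_pow_of_isNilpotent h).eq_zero
  have h2 := Matrix.aeval_self_charpoly x
  rw [sub_eq_zero.1 h1] at h2
  simpa using h2

variable {L : Type*} [LieRing L] [LieAlgebra ℂ L]

theorem exists_finrank_ker_eq_one (h : lieIndex L = 1) :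
    ∃ φ : Dual ℂ L, finrank ℂ (LinearMap.ker (kirillovForm φ)) = 1 := by
  have : lieIndex L ∈ Set.range fun φ : Dual ℂ L => finrank ℂ (LinearMap.ker (kirillovForm φ)) :=
    Nat.sInf_mem (Set.range_nonempty _)
  rwa [h] at this

variable [FiniteDimensional ℂ L]

/-- Semicontinuity bounds the radical of a generic member of the pencil by 1, and parity excludes 0.
-/
theorem finite_setOf_finrank_ker_ne_one (ψ : Dual ℂ L) {φ : Dual ℂ L}
    (h : finrank ℂ (LinearMap.ker (kirillovForm φ)) = 1) :
    {t : ℂ | finrank ℂ (LinearMap.ker (kirillovForm (ψ + t • φ))) ≠ 1}.Finite := by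
  refine (exists_smul_add_finrank_ker_le (kirillovForm ψ) (kirillovForm φ)).subset
    fun t ht hle => ht ?_
  have h1 : kirillovForm (ψ + t • φ) = kirillovForm ψ + t • kirillovForm φ := rfl
  rw [← h1, h] at hle
  obtain ⟨k, -, -, hk⟩ := exists_finrank_eq_two_mul_add φ
  obtain ⟨m, -, -, hm⟩ := exists_finrank_eq_two_mul_add (ψ + t • φ)
  omega

/-- If `φ` has a one-dimensional radical spanned by `x` and the Lie algebra is not contact, then
`x` is a commutator of itself with some element. -/
theorem exists_lie_eq_self_of_not_isContact (hL : ¬ IsContact L) {φ : Dual ℂ L}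
    (h : finrank ℂ (LinearMap.ker (kirillovForm φ)) = 1) {x : L}
    (hx : x ∈ LinearMap.ker (kirillovForm φ)) : ∃ y, ⁅x, y⁆ = x := by
  by_contra hne
  have hx' : x ∉ LinearMap.range (LieAlgebra.ad ℂ L x : L →ₗ[ℂ] L) := by
    rintro ⟨y, hy⟩
    exact hne ⟨y, hy⟩
  -- `x` lies in the radical of `χ` and of `φ`, hence of every `χ + t • φ`; a generic `t` makes that
  -- radical a line, and the value at `x` remains `χ x` because `φ x = 0`.
  obtain ⟨χ, hχ, hle⟩ := Submodule.exists_le_ker_of_notMem hx'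
  obtain ⟨t, ht⟩ := (finite_setOf_finrank_ker_ne_one χ h).infinite_compl.nonempty
  have ht : finrank ℂ (LinearMap.ker (kirillovForm (χ + t • φ))) = 1 := not_not.1 ht
  have h0 : φ x = 0 := by
    by_contra h0
    exact hL (isContact_of_ker_kirillovForm h hx h0)
  refine hL (isContact_of_ker_kirillovForm ht (x := x) ?_ (by simpa [h0] using hχ))
  rw [mem_ker_kirillovForm] at hx ⊢
  intro y
  have h1 : χ ⁅x, y⁆ = 0 := hle ⟨y, rfl⟩
  simp [h1, hx]

end IndexOne

/-! ### The limit argument -/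

section Limit

open Filter Topology

attribute [local instance] Matrix.normedAddCommGroup Matrix.normedSpace

/-- Without a contact form, the radicals of `φ₁ + t • φ` for generic small `t` are lines of
nilpotent matrices. Unit vectors in them accumulate at a unit nilpotent in the radical of `φ₁`. -/
theorem isContact_of_lieIndex_eq_one {N : ℕ} (g : LieSubalgebra ℂ (Matrix (Fin N) (Fin N) ℂ))
    (φ₁ : Dual ℂ g)
    (h : ∀ x ∈ LinearMap.ker (kirillovForm φ₁), IsNilpotent (x : Matrix (Fin N) (Fin N) ℂ) → x = 0)
    (hind : lieIndex g = 1) : IsContact g := by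
  by_contra hL
  obtain ⟨φ, hφ⟩ := exists_finrank_ker_eq_one hind
  -- Both forms are extended to all matrices, so that the limit can be taken in the ambient space.
  obtain ⟨Φ₁, hΦ₁⟩ := LinearMap.exists_extend (p := g.toSubmodule) φ₁
  obtain ⟨Φ, hΦ⟩ := LinearMap.exists_extend (p := g.toSubmodule) φ
  have hfin := finite_setOf_finrank_ker_ne_one φ₁ hφ
  -- The bad parameters are finite in number, so good ones accumulate at 0.
  obtain ⟨t, ht, htlim⟩ := mem_closure_iff_seq_limit.1
    ((hfin.countable.dense_compl ℂ) (0 : ℂ))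
  have hx : ∀ n, ∃ x : g, ‖(x : Matrix (Fin N) (Fin N) ℂ)‖ = 1 ∧
      (x : Matrix (Fin N) (Fin N) ℂ) ^ N = 0 ∧
      x ∈ LinearMap.ker (kirillovForm (φ₁ + t n • φ)) := by
    intro n
    have h1 : finrank ℂ (LinearMap.ker (kirillovForm (φ₁ + t n • φ))) = 1 := not_not.1 (ht n)
    obtain ⟨⟨z, hz⟩, hz0, -⟩ := finrank_eq_one_iff'.1 h1
    have hz0' : ‖(z : Matrix (Fin N) (Fin N) ℂ)‖ ≠ 0 := by
      rw [norm_ne_zero_iff]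
      exact fun h => hz0 (Subtype.ext (Subtype.ext h))
    refine ⟨((‖(z : Matrix (Fin N) (Fin N) ℂ)‖⁻¹ : ℝ) : ℂ) • z, ?_, ?_, Submodule.smul_mem _ _ hz⟩
    · change ‖((‖(z : Matrix (Fin N) (Fin N) ℂ)‖⁻¹ : ℝ) : ℂ) • (z : Matrix (Fin N) (Fin N) ℂ)‖ = 1
      rw [norm_smul, Complex.norm_real, norm_inv, norm_norm, inv_mul_cancel₀ hz0']
    · obtain ⟨y, hy⟩ := exists_lie_eq_self_of_not_isContact hL h1 hz
      have hnil : IsNilpotent (z : Matrix (Fin N) (Fin N) ℂ) :=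
        isNilpotent_of_commutator_eq (y := (y : Matrix (Fin N) (Fin N) ℂ))
          (congrArg Subtype.val hy)
      change (((‖(z : Matrix (Fin N) (Fin N) ℂ)‖⁻¹ : ℝ) : ℂ) •
        (z : Matrix (Fin N) (Fin N) ℂ)) ^ N = 0
      rw [smul_pow, pow_card_eq_zero_of_isNilpotent hnil, smul_zero]
  choose x hx1 hxN hxk using hx
  obtain ⟨a, ha, s, hs, hlim⟩ := (isCompact_sphere (0 : Matrix (Fin N) (Fin N) ℂ) 1).tendsto_subseq
    (x := fun n => (x n : Matrix (Fin N) (Fin N) ℂ)) (fun n => by simp [hx1])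
  have hag : a ∈ g := by
    have hcl : IsClosed (g.toSubmodule : Set (Matrix (Fin N) (Fin N) ℂ)) :=
      Submodule.closed_of_finiteDimensional _
    exact hcl.mem_of_tendsto hlim (Eventually.of_forall fun n => (x (s n)).2)
  have haN : a ^ N = 0 := by
    have h1 : Tendsto (fun n => (x (s n) : Matrix (Fin N) (Fin N) ℂ) ^ N) atTop (𝓝 (a ^ N)) :=
      ((continuous_id.pow N).tendsto a).comp hlim
    simp only [hxN] at h1
    exact tendsto_nhds_unique h1 tendsto_const_nhds |>.trans rfl
  have ha0 : (⟨a, hag⟩ : g) = 0 := by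
    refine h _ (mem_ker_kirillovForm.2 fun y => ?_) ⟨N, haN⟩
    set Y : Matrix (Fin N) (Fin N) ℂ := y.val
    have hcont : Continuous fun p : ℂ × Matrix (Fin N) (Fin N) ℂ =>
        Φ₁ (p.2 * Y - Y * p.2) + p.1 * Φ (p.2 * Y - Y * p.2) := by
      have c1 : Continuous Φ₁ := LinearMap.continuous_of_finiteDimensional _
      have c2 : Continuous Φ := LinearMap.continuous_of_finiteDimensional _
      fun_prop
    have h1 := (hcont.tendsto (0, a)).comp ((htlim.comp hs.tendsto_atTop).prodMk_nhds hlim)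
    have h2 : ∀ z w : g, Φ₁ ((z : Matrix (Fin N) (Fin N) ℂ) * w - w * z) = φ₁ ⁅z, w⁆ := fun z w =>
      LinearMap.congr_fun hΦ₁ ⁅z, w⁆
    have h3 : ∀ z w : g, Φ ((z : Matrix (Fin N) (Fin N) ℂ) * w - w * z) = φ ⁅z, w⁆ := fun z w =>
      LinearMap.congr_fun hΦ ⁅z, w⁆
    have h4 : ∀ n, Φ₁ ((x n : Matrix (Fin N) (Fin N) ℂ) * Y - Y * x n) +
        t n * Φ ((x n : Matrix (Fin N) (Fin N) ℂ) * Y - Y * x n) = 0 := fun n => by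
      rw [h2, h3]
      exact mem_ker_kirillovForm.1 (hxk n) y
    have h5 := tendsto_nhds_unique h1
      ((tendsto_const_nhds (x := (0 : ℂ))).congr fun n => (h4 (s n)).symm)
    rw [← h2 ⟨a, hag⟩ y]
    simpa using h5
  have : a = 0 := congrArg Subtype.val ha0
  rw [this] at ha
  simp at ha

end Limit

/-! ### Forms without nilpotent stabilizers: splitting off and pairing blocks -/

section NilFree

/-- The matrix `F` represents a one-form `y ↦ tr (F y)` on the matrices supported on `r` whose
stabilizer contains no nonzero nilpotent matrix. -/
structure NilFree {ι : Type*} [Fintype ι] [DecidableEq ι] (r : ι → ι → Prop) (F : Matrix ι ι ℂ) :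
    Prop where
  supp : ∀ i j, ¬ r j i → F i j = 0
  eq_zero : ∀ x : Matrix ι ι ℂ, (∀ i j, ¬ r i j → x i j = 0) →
    (∀ i j, r i j → (F * x) j i = (x * F) j i) → IsNilpotent x → x = 0

/-- For a projection `q` with `x`-invariant kernel, `q * x` is the map induced on the quotient, and
nilpotency descends to it. -/
theorem isNilpotent_mul_of_mul_mul_eq {R : Type*} [Ring R] {q x : R} (h : q * x * q = q * x)
    (hx : IsNilpotent x) : ∃ m, q * x ^ m = 0 ∧ (q * x) ^ m = 0 := by
  have key : ∀ m, (q * x) ^ m * q = q * x ^ m := by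
    intro m
    induction m with
    | zero => simp
    | succ m ih => rw [pow_succ', mul_assoc, ih, ← mul_assoc, h, pow_succ' x, mul_assoc]
  obtain ⟨m, hm⟩ := hx
  refine ⟨m + 1, by rw [pow_succ, hm, zero_mul, mul_zero], ?_⟩
  rw [pow_succ, ← mul_assoc, key, hm, mul_zero, zero_mul]

variable {ι : Type*} [Fintype ι] [DecidableEq ι]

theorem NilFree.transpose {r : ι → ι → Prop} {F : Matrix ι ι ℂ} (h : NilFree r F) :
    NilFree (fun i j => r j i) F.transpose where
  supp i j hij := h.supp j i hij
  eq_zero x hx hFx hn := by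
    have hn' : IsNilpotent x.transpose := by
      obtain ⟨m, hm⟩ := hn
      exact ⟨m, by rw [← Matrix.transpose_pow, hm, Matrix.transpose_zero]⟩
    have := h.eq_zero x.transpose (fun i j hij => hx j i hij) (fun i j hij => ?_) hn'
    · simpa using this
    · have h1 := hFx j i hij
      rw [← Matrix.transpose_apply (F.transpose * x), ← Matrix.transpose_apply (x * F.transpose),
        Matrix.transpose_mul, Matrix.transpose_mul, Matrix.transpose_transpose] at h1
      exact h1.symm

open Classical in
/-- The diagonal matrix with entries `d i` for `i ∈ I`. -/
noncomputable def diagOn (I : Set ι) (d : ι → ℂ) : Matrix ι ι ℂ :=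
  Matrix.diagonal fun i => if i ∈ I then d i else 0

open Classical in
theorem diagOn_mul (I : Set ι) (d : ι → ℂ) (x : Matrix ι ι ℂ) (i j : ι) :
    (diagOn I d * x) i j = if i ∈ I then d i * x i j else 0 := by
  rw [diagOn, Matrix.diagonal_mul, ite_mul, zero_mul]

open Classical in
theorem mul_diagOn (I : Set ι) (d : ι → ℂ) (x : Matrix ι ι ℂ) (i j : ι) :
    (x * diagOn I d) i j = if j ∈ I then x i j * d j else 0 := by
  rw [diagOn, Matrix.mul_diagonal, mul_ite, mul_zero]

/-- Adding a full diagonal block on `I`, with a diagonal one-form with distinct entries. -/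
theorem NilFree.add_block {r r' : ι → ι → Prop} {F : Matrix ι ι ℂ} (h : NilFree r' F)
    {I : Set ι} (hr' : ∀ i j, r' i j → i ∉ I ∧ j ∉ I)
    (hr : ∀ i j, r i j ↔ (i ∈ I ∧ j ∈ I) ∨ r' i j) {d : ι → ℂ} (hd : Set.InjOn d I) :
    NilFree r (F + diagOn I d) := by
  classical
  refine ⟨fun i j hij => ?_, fun x hx hFx hn => ?_⟩
  · rw [hr, not_or] at hij
    rw [Matrix.add_apply, h.supp i j hij.2, zero_add, diagOn, Matrix.diagonal_apply]
    split_ifs with h1 h2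
    · subst h1
      exact absurd ⟨h2, h2⟩ hij.1
    · rfl
    · rfl
  -- `F` has no entries in the rows and columns of `I`, so on `I × I` the stabilizer equation says
  -- `(d j - d i) * x j i = 0`.
  · have hoff : ∀ i ∈ I, ∀ j, i ≠ j → x i j = 0 := by
      intro j hj i hji
      by_cases hi : i ∈ I
      · have h1 := hFx i j ((hr i j).2 (Or.inl ⟨hi, hj⟩))
        have h2 : (F * x) j i = 0 := by
          rw [Matrix.mul_apply]
          refine Finset.sum_eq_zero fun k _ => ?_
          rw [h.supp j k fun hk => (hr' _ _ hk).2 hj, zero_mul]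
        have h3 : (x * F) j i = 0 := by
          rw [Matrix.mul_apply]
          refine Finset.sum_eq_zero fun k _ => ?_
          rw [h.supp k i fun hk => (hr' _ _ hk).1 hi, mul_zero]
        rw [Matrix.add_mul, Matrix.mul_add, Matrix.add_apply, Matrix.add_apply, h2, h3, diagOn_mul,
          mul_diagOn, if_pos hj, if_pos hi, zero_add, zero_add] at h1
        have h4 : (d j - d i) * x j i = 0 := by linear_combination h1
        exact (mul_eq_zero.1 h4).resolve_left (sub_ne_zero.2 fun h5 => hji (hd hj hi h5))
      · exact hx j i fun hji' => ((hr j i).1 hji').elim (fun h => hi h.2) fun h => (hr' _ _ h).1 hj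
    have hdiag : ∀ i ∈ I, x i i = 0 := by
      intro i hi
      have hpow : ∀ m : ℕ, (x ^ m) i i = x i i ^ m := by
        intro m
        induction m with
        | zero => simp
        | succ m ih =>
          rw [pow_succ', Matrix.mul_apply, Finset.sum_eq_single i, ih, pow_succ']
          · intro k _ hk
            rw [hoff i hi k hk.symm, zero_mul]
          · simp
      obtain ⟨m, hm⟩ := hn
      have := hpow m
      rw [hm, Matrix.zero_apply] at this
      by_contra h0
      exact pow_ne_zero m h0 this.symm
    refine h.eq_zero x (fun i j hij => ?_) (fun i j hij => ?_) hn
    · by_cases hi : i ∈ I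
      · by_cases h1 : i = j
        · exact h1 ▸ hdiag i hi
        · exact hoff i hi j h1
      · exact hx i j fun h1 => ((hr i j).1 h1).elim (fun h2 => hi h2.1) hij
    · have h1 := hFx i j ((hr i j).2 (Or.inr hij))
      rwa [Matrix.add_mul, Matrix.mul_add, Matrix.add_apply, Matrix.add_apply, diagOn_mul,
        mul_diagOn, if_neg (hr' _ _ hij).1, if_neg (hr' _ _ hij).2, add_zero, add_zero] at h1

open Classical in
/-- The matrix with entries `c` at the positions `(e i, i)` for `i ∈ I`. -/
noncomputable def shiftOn (I : Set ι) (e : Equiv.Perm ι) (c : ℂ) : Matrix ι ι ℂ :=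
  Matrix.of fun j i => if i ∈ I ∧ j = e i then c else 0

open Classical in
theorem shiftOn_mul (I : Set ι) (e : Equiv.Perm ι) (c : ℂ) (x : Matrix ι ι ℂ) (j i : ι) :
    (shiftOn I e c * x) j i = if e.symm j ∈ I then c * x (e.symm j) i else 0 := by
  rw [Matrix.mul_apply, Finset.sum_eq_single (e.symm j)]
  · simp [shiftOn]
  · intro k _ hk
    rw [shiftOn, Matrix.of_apply, if_neg, zero_mul]
    rintro ⟨-, rfl⟩
    simp at hk
  · simp

open Classical in
theorem mul_shiftOn (I : Set ι) (e : Equiv.Perm ι) (c : ℂ) (x : Matrix ι ι ℂ) (j i : ι) :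
    (x * shiftOn I e c) j i = if i ∈ I then x j (e i) * c else 0 := by
  rw [Matrix.mul_apply, Finset.sum_eq_single (e i)]
  · simp [shiftOn]
  · intro k _ hk
    rw [shiftOn, Matrix.of_apply, if_neg fun h => hk h.2, mul_zero]
  · simp

/-- Panyushev's reduction for a first block which is at most half as long as the block on the other
side: the block `I` is paired with `K`, and the complement of `I` remains, with the maps from `K` to
`J` removed. -/
theorem NilFree.pair_block {r r' : ι → ι → Prop} {F : Matrix ι ι ℂ} {I J K : Set ι}
    {e : Equiv.Perm ι} {c : ℂ} {d : ι → ℂ} (hc : c ≠ 0)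
    (he : ∀ i, e i ∈ K ↔ i ∈ I)
    (hIK : Disjoint I K)
    (hI : ∀ i ∈ I, ∀ j, r i j ↔ j ∈ I ∨ j ∈ J ∨ j ∈ K)
    (hI' : ∀ i ∈ I, ∀ j, r j i → j ∈ I)
    (hJI : Disjoint I J) (hJK' : Disjoint J K)
    (hJK : ∀ i ∈ J, ∀ j ∈ K, r i j)
    (hr' : ∀ i j, r' i j ↔ r i j ∧ i ∉ I ∧ ¬ (i ∈ J ∧ j ∈ K))
    (hd : (∀ i, d i = 0) ∨ ∀ i j, r' i j → (i ∈ K ↔ j ∈ K))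
    (hF : ∀ i j, ¬ r' j i → F i j = 0)
    (h : NilFree r' (F + diagOn K (d ∘ e.symm))) :
    NilFree r (F + shiftOn I e c + diagOn I d) := by
  classical
  have heK : ∀ {k}, k ∈ K → e.symm k ∈ I := fun {k} hk => (he _).1 (by simpa using hk)
  have heI : ∀ {k}, e.symm k ∈ I ↔ k ∈ K := fun {k} => by rw [← he]; simp
  refine ⟨fun j i hij => ?_, fun x hx hFx hn => ?_⟩
  · have h1 : ¬ r' i j := fun h1 => hij ((hr' _ _).1 h1).1
    rw [Matrix.add_apply, Matrix.add_apply, hF j i h1, shiftOn, Matrix.of_apply, if_neg, diagOn,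
      Matrix.diagonal_apply]
    · split_ifs with h2 h3
      · subst h2
        exact absurd ((hI _ h3 _).2 (Or.inl h3)) hij
      · simp
      · simp
    · rintro ⟨h2, rfl⟩
      exact hij ((hI i h2 _).2 (Or.inr (Or.inr ((he i).2 h2))))
  have hFI : ∀ i ∈ I, ∀ k, F k i = 0 := fun i hi k => hF k i fun h1 => ((hr' _ _).1 h1).2.1 hi
  have hxI : ∀ i ∈ I, ∀ j ∉ I, x j i = 0 := fun i hi j hj => hx j i fun h1 => hj (hI' i hi j h1)
  have hxF : ∀ i ∈ I, ∀ j, (x * F) j i = 0 := fun i hi j => by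
    rw [Matrix.mul_apply]
    exact Finset.sum_eq_zero fun k _ => by rw [hFI i hi, mul_zero]
  have hFx1 : ∀ i ∈ I, ∀ j, (F * x) j i = 0 := fun i hi j => by
    rw [Matrix.mul_apply]
    refine Finset.sum_eq_zero fun k _ => ?_
    by_cases hk : k ∈ I
    · rw [hFI k hk, zero_mul]
    · rw [hxI i hi k hk, mul_zero]
  -- The stabilizer equation entry by entry. With `i ∈ I` and `j` in `J`, `K`, `I` in turn it gives
  -- `s1`, `s2`, `s3`.
  have eqn : ∀ i j, r i j → (F * x) j i + (if j ∈ K then c * x (e.symm j) i else 0) +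
      (if j ∈ I then d j * x j i else 0) = (x * F) j i + (if i ∈ I then x j (e i) * c else 0) +
      (if i ∈ I then x j i * d i else 0) := by
    intro i j hij
    have := hFx i j hij
    simpa only [Matrix.add_mul, Matrix.mul_add, Matrix.add_apply, shiftOn_mul, mul_shiftOn,
      diagOn_mul, mul_diagOn, heI] using this
  have hnI : ∀ {k}, k ∈ K → k ∉ I := fun {k} hk hk' => Set.disjoint_left.1 hIK hk' hk
  have hJnI : ∀ {k}, k ∈ J → k ∉ I := fun {k} hk hk' => Set.disjoint_left.1 hJI hk' hk
  -- The positions `J × K`, absent from `r'`, carry no entry of `x`.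
  have s1 : ∀ j ∈ J, ∀ k ∈ K, x j k = 0 := by
    intro j hj k hk
    have hjK : j ∉ K := fun hjK => Set.disjoint_left.1 hJK' hj hjK
    have h1 := eqn (e.symm k) j ((hI _ (heK hk) _).2 (Or.inr (Or.inl hj)))
    rw [if_neg hjK, if_neg (hJnI hj), if_pos (heK hk), if_pos (heK hk), hFx1 _ (heK hk),
      hxF _ (heK hk), hxI _ (heK hk) _ (hJnI hj), e.apply_symm_apply] at h1
    have : x j k * c = 0 := by linear_combination - h1
    exact (mul_eq_zero.1 this).resolve_right hc
  -- The pairing identifies the `I × I` block of `x` with its `K × K` block.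
  have s2 : ∀ j ∈ K, ∀ k ∈ K, x (e.symm j) (e.symm k) = x j k := by
    intro j hj k hk
    have h1 := eqn (e.symm k) j ((hI _ (heK hk) _).2 (Or.inr (Or.inr hj)))
    rw [if_pos hj, if_neg (hnI hj), if_pos (heK hk), if_pos (heK hk), hFx1 _ (heK hk),
      hxF _ (heK hk), hxI _ (heK hk) _ (hnI hj), e.apply_symm_apply] at h1
    have : c * (x (e.symm j) (e.symm k) - x j k) = 0 := by linear_combination h1
    exact sub_eq_zero.1 ((mul_eq_zero.1 this).resolve_left hc)
  -- The `I × K` entries form a commutator with `d`; on `K` this becomes the diagonal form `d ∘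
  -- e.symm` of the smaller algebra.
  have s3 : ∀ j ∈ I, ∀ k ∈ K, x j k * c = d j * x j (e.symm k) - x j (e.symm k) * d (e.symm k) := by
    intro j hj k hk
    have h1 := eqn (e.symm k) j ((hI _ (heK hk) _).2 (Or.inl hj))
    rw [if_neg fun h => hnI h hj, if_pos hj, if_pos (heK hk), if_pos (heK hk), hFx1 _ (heK hk),
      hxF _ (heK hk), e.apply_symm_apply] at h1
    linear_combination - h1
  -- Outside the rows `I` the columns `I` of `x` are empty, so deleting the rows `I` yields an
  -- induced map on a quotient, which is again nilpotent. It is the candidate element of the smaller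
  -- algebra.
  have hq : diagOn Iᶜ 1 * x * diagOn Iᶜ 1 = diagOn Iᶜ 1 * x := by
    ext i j
    rw [mul_diagOn, diagOn_mul]
    simp only [Set.mem_compl_iff, Pi.one_apply, one_mul, mul_one]
    by_cases h1 : j ∈ I <;> by_cases h2 : i ∈ I <;> simp [h1, h2]
    exact (hxI j h1 i h2).symm
  have hq' : ∀ i j, (diagOn Iᶜ 1 * x) i j = if i ∈ I then 0 else x i j := fun i j => by
    rw [diagOn_mul]
    simp only [Set.mem_compl_iff, Pi.one_apply, one_mul]
    split_ifs <;> rfl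
  obtain ⟨m, -, hm⟩ := isNilpotent_mul_of_mul_mul_eq hq hn
  have hzero := h.eq_zero (diagOn Iᶜ 1 * x) (fun i j hij => ?_) (fun i j hij => ?_) ⟨m, hm⟩
  · have z1 : ∀ i ∉ I, ∀ j, x i j = 0 := fun i hi j => by
      have := congrFun (congrFun hzero i) j
      rwa [hq', if_neg hi] at this
    have z2 : ∀ i ∈ I, ∀ j ∈ I, x i j = 0 := fun i hi j hj => by
      have := s2 (e i) ((he i).2 hi) (e j) ((he j).2 hj)
      rwa [e.symm_apply_apply, e.symm_apply_apply, z1 _ (hnI ((he i).2 hi))] at this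
    have z3 : ∀ i ∈ I, ∀ j ∈ K, x i j = 0 := fun i hi j hj => by
      have := s3 i hi j hj
      rw [z2 i hi _ (heK hj), mul_zero, zero_mul, sub_zero] at this
      exact (mul_eq_zero.1 this).resolve_right hc
    ext i j
    by_cases hi : i ∈ I
    · by_cases hij : r i j
      · rcases (hI i hi j).1 hij with hj | hj | hj
        · exact z2 i hi j hj
        -- The `I × J` entries, untouched so far, are seen by testing against the dropped positions
        -- `J × K`.
        · have h1 := eqn j (e i) (hJK j hj _ ((he i).2 hi))
          have h2 : (F * x) (e i) j = 0 := by
            rw [Matrix.mul_apply]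
            refine Finset.sum_eq_zero fun k _ => ?_
            by_cases hk : k ∈ I
            · rw [hFI k hk, zero_mul]
            · rw [z1 k hk, mul_zero]
          have h3 : (x * F) (e i) j = 0 := by
            rw [Matrix.mul_apply]
            exact Finset.sum_eq_zero fun k _ => by
              rw [z1 _ (hnI ((he i).2 hi)), zero_mul]
          rw [if_pos ((he i).2 hi), if_neg (hnI ((he i).2 hi)), if_neg (hJnI hj),
            if_neg (hJnI hj), h2, h3, e.symm_apply_apply] at h1
          have : c * x i j = 0 := by linear_combination h1
          exact (mul_eq_zero.1 this).resolve_left hc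
        · exact z3 i hi j hj
      · exact hx i j hij
    · exact z1 i hi j
  · rw [hq']
    split_ifs with hi
    · rfl
    · by_cases h1 : r i j
      · have h2 : i ∈ J ∧ j ∈ K := by
          by_contra h2
          exact hij ((hr' i j).2 ⟨h1, hi, h2⟩)
        exact s1 i h2.1 j h2.2
      · exact hx i j h1
  · obtain ⟨hij', hi, hnJK⟩ := (hr' i j).1 hij
    have hj : j ∉ I := fun hj => hi (hI' j hj i hij')
    have h1 := eqn i j hij'
    rw [if_neg hj, if_neg hi, if_neg hi, add_zero, add_zero, add_zero] at h1
    have e1 : (F * (diagOn Iᶜ 1 * x)) j i = (F * x) j i := by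
      rw [Matrix.mul_apply, Matrix.mul_apply]
      refine Finset.sum_congr rfl fun k _ => ?_
      rw [hq']
      split_ifs with hk
      · rw [hFI k hk, zero_mul, zero_mul]
      · rfl
    have e2 : ((diagOn Iᶜ 1 * x) * F) j i = (x * F) j i := by
      rw [Matrix.mul_apply, Matrix.mul_apply]
      refine Finset.sum_congr rfl fun k _ => ?_
      rw [hq', if_neg hj]
    rw [Matrix.add_mul, Matrix.mul_add, Matrix.add_apply, Matrix.add_apply, e1, e2, diagOn_mul,
      mul_diagOn, hq', if_neg hj, ← h1]
    have hRI : j ∈ K → i ∉ K → x (e.symm j) i = 0 := by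
      intro hjK hiK
      refine hx _ _ fun h2 => ?_
      rcases (hI _ (heK hjK) _).1 h2 with h3 | h3 | h3
      · exact hi h3
      · exact hnJK ⟨h3, hjK⟩
      · exact hiK h3
    simp only [Function.comp_apply]
    by_cases hjK : j ∈ K <;> by_cases hiK : i ∈ K
    · rw [if_pos hjK, if_pos hiK, if_pos hjK]
      have h2 := s3 _ (heK hjK) i hiK
      rw [s2 j hjK i hiK] at h2
      linear_combination - h2
    · rw [if_pos hjK, if_neg hiK, if_pos hjK, hRI hjK hiK]
      rcases hd with hd | hd
      · rw [hd]; ring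
      · exact absurd ((hd i j hij).2 hjK) hiK
    · rw [if_neg hjK, if_pos hiK, if_neg hjK]
      rcases hd with hd | hd
      · rw [hd]; ring
      · exact absurd ((hd i j hij).1 hiK) hjK
    · rw [if_neg hjK, if_neg hiK, if_neg hjK]
      ring

end NilFree

/-! ### Forms without nilpotent stabilizers: shifting a long block -/

section ShiftBlock

variable {ι : Type*} [Fintype ι] [DecidableEq ι]

open Classical in
/-- The one-form obtained from `F` by pairing `I₁` with `K = e '' I₁` and moving the entries of `F`
at `K × I₂` to `I₁ × I₂`. -/
noncomputable def moveOn (I₁ I₂ K : Set ι) (e : Equiv.Perm ι) (c : ℂ) (F : Matrix ι ι ℂ) :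
    Matrix ι ι ℂ :=
  Matrix.of fun j i =>
    if i ∈ I₂ then (if j ∈ K then 0 else if j ∈ I₁ then F (e j) i else F j i)
    else if i ∈ I₁ then (if j = e i then c else 0) else F j i

/-- `y` agrees with `x` on the quotient cut out by `p` and on the subspace cut out by `q`, and these
two corners carry all of `y`. A high power of `y` dies under `p`, so it has values in the range of
`q`, where a further power vanishes. -/
theorem isNilpotent_of_corner {R : Type*} [Ring R] {p q x y : R} (hpq : (p + q) * y = y)
    (hp : p * x * p = p * x) (hpy : p * y = p * x) (hq : q * x * q = x * q)
    (hqy : y * q = x * q) (hx : IsNilpotent x) : IsNilpotent y := by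
  have h1 : ∀ m, (p * y) ^ m * p = p * y ^ m := by
    intro m
    induction m with
    | zero => simp
    | succ m ih => rw [pow_succ', mul_assoc, ih, hpy, ← mul_assoc, hp, pow_succ' y, ← hpy,
      mul_assoc]
  have h2 : ∀ m, q * (y * q) ^ m = y ^ m * q := by
    intro m
    induction m with
    | zero => simp
    | succ m ih =>
      rw [pow_succ, ← mul_assoc, ih, hqy, mul_assoc, ← mul_assoc q, hq, ← hqy, ← mul_assoc,
        ← pow_succ]
  obtain ⟨m, -, hm⟩ := isNilpotent_mul_of_mul_mul_eq hp hx
  have h3 : ∀ m, q * (x * q) ^ m = x ^ m * q := by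
    intro m
    induction m with
    | zero => simp
    | succ m ih => rw [pow_succ, ← mul_assoc, ih, mul_assoc, ← mul_assoc q, hq, ← mul_assoc,
        ← pow_succ]
  obtain ⟨l, hl⟩ := hx
  refine ⟨l + (m + 1), ?_⟩
  have e1 : p * y ^ (m + 1) = 0 := by
    rw [pow_succ, ← mul_assoc, ← h1, hpy, hm, zero_mul, zero_mul]
  have e2 : y ^ l * q = 0 := by
    rw [← h2, hqy, h3, hl, zero_mul]
  have e3 : y ^ (m + 1) = (p + q) * y ^ (m + 1) := by
    rw [pow_succ', ← mul_assoc, hpq]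
  rw [pow_add, e3, add_mul, e1, zero_add, ← mul_assoc, e2, zero_mul]

/-- Panyushev's reduction for a first block `I₁ ∪ I₂` which is more than half as long as the block
`I₁ ∪ I₂ ∪ K` on the other side. -/
theorem NilFree.shift_block {r r' : ι → ι → Prop} {F : Matrix ι ι ℂ} {I₁ I₂ K : Set ι}
    {e : Equiv.Perm ι} {c : ℂ} (hc : c ≠ 0) (he : ∀ i, e i ∈ K ↔ i ∈ I₁)
    (h12 : Disjoint I₁ I₂) (h1K : Disjoint I₁ K) (h2K : Disjoint I₂ K)
    (hI : ∀ i, i ∈ I₁ ∨ i ∈ I₂ → ∀ j, r i j ↔ j ∈ I₁ ∨ j ∈ I₂ ∨ j ∈ K)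
    (hI' : ∀ i, i ∈ I₁ ∨ i ∈ I₂ → ∀ j, r j i → j ∈ I₁ ∨ j ∈ I₂)
    (hr' : ∀ i j, r' i j ↔ r i j ∧ i ∉ I₁ ∧ j ∉ I₁)
    (h : NilFree r' F) : NilFree r (moveOn I₁ I₂ K e c F) := by
  classical
  have heK : ∀ {k}, k ∈ K → e.symm k ∈ I₁ := fun {k} hk => (he _).1 (by simpa using hk)
  have n12 : ∀ {i}, i ∈ I₁ → i ∉ I₂ := fun {i} h => Set.disjoint_left.1 h12 h
  have n21 : ∀ {i}, i ∈ I₂ → i ∉ I₁ := fun {i} h => Set.disjoint_right.1 h12 h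
  have n1K : ∀ {i}, i ∈ I₁ → i ∉ K := fun {i} h => Set.disjoint_left.1 h1K h
  have nK1 : ∀ {i}, i ∈ K → i ∉ I₁ := fun {i} h => Set.disjoint_right.1 h1K h
  have n2K : ∀ {i}, i ∈ I₂ → i ∉ K := fun {i} h => Set.disjoint_left.1 h2K h
  have nK2 : ∀ {i}, i ∈ K → i ∉ I₂ := fun {i} h => Set.disjoint_right.1 h2K h
  refine ⟨fun j i hij => ?_, fun x hx hFx hn => ?_⟩
  · have h1 : F j i = 0 := h.supp j i fun h1 => hij ((hr' _ _).1 h1).1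
    rw [moveOn, Matrix.of_apply]
    split_ifs with a1 a2 a3 a4 a5
    · rfl
    · exact absurd ((hI i (Or.inr a1) j).2 (Or.inl a3)) hij
    · exact h1
    · exact absurd ((hI i (Or.inl a4) j).2 (Or.inr (Or.inr (a5 ▸ (he i).2 a4)))) hij
    · rfl
    · exact h1
  have F1 : ∀ i ∈ I₁, ∀ k, F k i = 0 := fun i hi k => h.supp k i fun h1 => ((hr' _ _).1 h1).2.1 hi
  have F1' : ∀ i ∈ I₁, ∀ k, F i k = 0 := fun i hi k => h.supp i k fun h1 =>
    ((hr' _ _).1 h1).2.2 hi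
  have F2 : ∀ i ∈ I₂, ∀ k, k ∉ I₂ → F i k = 0 := fun i hi k hk => h.supp i k fun h1 => by
    obtain ⟨a, b, -⟩ := (hr' _ _).1 h1
    exact (hI' i (Or.inr hi) k a).elim b hk
  have F2' : ∀ i ∈ I₂, ∀ k, k ∉ I₂ → k ∉ K → F k i = 0 := fun i hi k hk hk' => h.supp k i fun h1 =>
      by
    obtain ⟨a, -, b⟩ := (hr' _ _).1 h1
    rcases (hI i (Or.inr hi) k).1 a with h2 | h2 | h2
    exacts [b h2, hk h2, hk' h2]
  have xI : ∀ i, i ∈ I₁ ∨ i ∈ I₂ → ∀ j, j ∉ I₁ → j ∉ I₂ → x j i = 0 := fun i hi j hj hj' =>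
    hx j i fun h1 => (hI' i hi j h1).elim hj hj'
  have xI' : ∀ j, j ∈ I₁ ∨ j ∈ I₂ → ∀ i, i ∉ I₁ → i ∉ I₂ → i ∉ K → x j i = 0 :=
    fun j hj i h1 h2 h3 => hx j i fun h4 => by
      rcases (hI j hj i).1 h4 with h5 | h5 | h5
      exacts [h1 h5, h2 h5, h3 h5]
  set G := moveOn I₁ I₂ K e c F with hG
  have row : ∀ j, j ∉ I₁ → ∀ k, G j k = shiftOn I₁ e c j k +
      (if j ∈ K ∧ k ∈ I₂ then 0 else F j k) := by
    intro j hj k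
    rw [hG, moveOn, shiftOn, Matrix.of_apply, Matrix.of_apply]
    by_cases k2 : k ∈ I₂
    · have := n21 k2
      simp [k2, this, hj]
    · by_cases k1 : k ∈ I₁
      · simp [k1, k2, F1 k k1]
      · simp [k1, k2]
  have GxK : ∀ j ∈ K, ∀ i, (G * x) j i = c * x (e.symm j) i +
      ∑ k, (if k ∈ I₂ then 0 else F j k * x k i) := by
    intro j hj i
    have h1 := shiftOn_mul I₁ e c x j i
    rw [if_pos (heK hj)] at h1
    rw [← h1, Matrix.mul_apply, Matrix.mul_apply, ← Finset.sum_add_distrib]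
    refine Finset.sum_congr rfl fun k _ => ?_
    rw [row j (nK1 hj) k]
    by_cases k2 : k ∈ I₂ <;> simp [hj, k2, add_mul]
  have Gx : ∀ j, j ∉ I₁ → j ∉ K → ∀ i, (G * x) j i = ∑ k, F j k * x k i := by
    intro j hj hjK i
    have h1 := shiftOn_mul I₁ e c x j i
    rw [if_neg fun h1 => hjK (by simpa using (he _).2 h1)] at h1
    rw [← zero_add (∑ k, _), ← h1, Matrix.mul_apply, Matrix.mul_apply, ← Finset.sum_add_distrib]
    refine Finset.sum_congr rfl fun k _ => ?_
    rw [row j hj k, if_neg fun h2 => hjK h2.1, add_mul]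
  have Gx1 : ∀ j ∈ I₁, ∀ i, (G * x) j i = ∑ k, (if k ∈ I₂ then F (e j) k * x k i else 0) := by
    intro j hj i
    rw [Matrix.mul_apply]
    refine Finset.sum_congr rfl fun k _ => ?_
    rw [hG, moveOn, Matrix.of_apply]
    by_cases k2 : k ∈ I₂
    · simp [k2, hj, n1K hj]
    · by_cases k1 : k ∈ I₁
      · have : j ≠ e k := fun h1 => n1K hj (h1 ▸ (he k).2 k1)
        simp [k2, k1, this]
      · simp [k2, k1, F1' j hj]
  have xG1 : ∀ i ∈ I₁, ∀ j, (x * G) j i = x j (e i) * c := by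
    intro i hi j
    rw [Matrix.mul_apply, Finset.sum_eq_single (e i)]
    · simp [hG, moveOn, hi, n12 hi]
    · intro k _ hk
      simp [hG, moveOn, hi, n12 hi, hk]
    · simp
  have xG2 : ∀ i ∈ I₂, ∀ j, (x * G) j i = ∑ k, (if k ∈ K then x j (e.symm k) * F k i else
      x j k * F k i) := by
    intro i hi j
    have e1 : ∑ k, (if k ∈ K then x j (e.symm k) * F k i else 0) =
        ∑ k, (if k ∈ I₁ then x j k * F (e k) i else 0) := by
      rw [← Equiv.sum_comp e]
      refine Finset.sum_congr rfl fun k _ => ?_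
      rw [e.symm_apply_apply]
      simp only [he]
    have e2 : ∀ k, (if k ∈ K then x j (e.symm k) * F k i else x j k * F k i) =
        (if k ∈ K then x j (e.symm k) * F k i else 0) + if k ∈ K then 0 else x j k * F k i :=
      fun k => by split_ifs <;> simp
    rw [Finset.sum_congr rfl fun k _ => e2 k, Finset.sum_add_distrib, e1, ← Finset.sum_add_distrib,
      Matrix.mul_apply]
    refine Finset.sum_congr rfl fun k _ => ?_
    rw [hG, moveOn, Matrix.of_apply, if_pos hi]
    by_cases kK : k ∈ K
    · simp [kK, nK1 kK]
    · by_cases k1 : k ∈ I₁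
      · simp [kK, k1, F1' k k1]
      · simp [kK, k1]
  have xG : ∀ i, i ∉ I₁ → i ∉ I₂ → ∀ j, (x * G) j i = ∑ k, x j k * F k i := by
    intro i h1 h2 j
    rw [Matrix.mul_apply]
    refine Finset.sum_congr rfl fun k _ => ?_
    simp [hG, moveOn, h1, h2]
  have s0 : ∀ j ∈ K, ∀ i, i ∈ I₁ ∨ i ∈ I₂ → (G * x) j i = c * x (e.symm j) i := by
    intro j hj i hi
    rw [GxK j hj, Finset.sum_eq_zero, add_zero]
    intro k _
    by_cases k2 : k ∈ I₂
    · rw [if_pos k2]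
    · rw [if_neg k2]
      by_cases k1 : k ∈ I₁
      · rw [F1 k k1, zero_mul]
      · rw [xI i hi k k1 k2, mul_zero]
  -- As for paired blocks, `e` identifies the `I₁ × I₁` block of `x` with its `K × K` block.
  have s1 : ∀ i ∈ I₁, ∀ j ∈ K, x (e.symm j) i = x j (e i) := by
    intro i hi j hj
    have h1 := hFx i j ((hI i (Or.inl hi) j).2 (Or.inr (Or.inr hj)))
    rw [s0 j hj i (Or.inl hi), xG1 i hi] at h1
    exact mul_left_cancel₀ hc (h1.trans (mul_comm _ _))
  -- Together with `xI`, this confines the columns `I₂` of `x` to the rows `I₂`, so that `I₂` spans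
  -- an invariant subspace.
  have s2 : ∀ i ∈ I₂, ∀ j ∈ I₁, x j i = 0 := by
    intro i hi j hj
    have hjK := (he j).2 hj
    have h1 := hFx i (e j) ((hI i (Or.inr hi) _).2 (Or.inr (Or.inr hjK)))
    rw [s0 _ hjK i (Or.inr hi), xG2 i hi, Finset.sum_eq_zero, e.symm_apply_apply] at h1
    · exact (mul_eq_zero.1 h1).resolve_left hc
    · intro k _
      by_cases kK : k ∈ K
      · rw [if_pos kK, xI _ (Or.inl (heK kK)) _ (nK1 hjK) (nK2 hjK), zero_mul]
      · rw [if_neg kK]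
        by_cases k2 : k ∈ I₂
        · rw [xI k (Or.inr k2) _ (nK1 hjK) (nK2 hjK), zero_mul]
        · rw [F2' i hi k k2 kK, mul_zero]
  have s3 : ∀ i ∈ I₁, ∀ j, j ∈ I₁ ∨ j ∈ I₂ → (G * x) j i = x j (e i) * c := by
    intro i hi j hj
    rw [hFx i j ((hI i (Or.inl hi) j).2 (hj.elim Or.inl fun h => Or.inr (Or.inl h))), xG1 i hi]
  -- The candidate element of the smaller algebra: `I₁` is deleted and the `I₂ × K` entries are
  -- replaced by the `I₂ × I₁` entries carried along `e`. This mirrors the relocation of the entries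
  -- of `F` in `moveOn`.
  set y : Matrix ι ι ℂ := Matrix.of fun j i => if j ∈ I₁ ∨ i ∈ I₁ then 0 else
    if j ∈ I₂ ∧ i ∈ K then x j (e.symm i) else x j i with hy
  have y1 : ∀ j ∈ I₁, ∀ i, y j i = 0 := fun j hj i => by simp [hy, hj]
  have y1' : ∀ i ∈ I₁, ∀ j, y j i = 0 := fun i hi j => by simp [hy, hi]
  have y2K : ∀ j ∈ I₂, ∀ i ∈ K, y j i = x j (e.symm i) := fun j hj i hi => by
    simp [hy, hj, hi, n21 hj, nK1 hi]
  have yx : ∀ j i, j ∉ I₁ → i ∉ I₁ → (j ∉ I₂ ∨ i ∉ K) → y j i = x j i := fun j i hj hi hji => by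
    rw [hy, Matrix.of_apply, if_neg (not_or.2 ⟨hj, hi⟩), if_neg (not_and_or.2 hji)]
  set p : Matrix ι ι ℂ := diagOn (I₁ ∪ I₂)ᶜ 1 with hp
  set q : Matrix ι ι ℂ := diagOn I₂ 1 with hq
  have pm : ∀ (z : Matrix ι ι ℂ) j i, (p * z) j i = if j ∈ I₁ ∨ j ∈ I₂ then 0 else z j i :=
    fun z j i => by
      rw [hp, diagOn_mul]
      by_cases h1 : j ∈ I₁ <;> by_cases h2 : j ∈ I₂ <;> simp [h1, h2]
  have mp : ∀ (z : Matrix ι ι ℂ) j i, (z * p) j i = if i ∈ I₁ ∨ i ∈ I₂ then 0 else z j i :=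
    fun z j i => by
      rw [hp, mul_diagOn]
      by_cases h1 : i ∈ I₁ <;> by_cases h2 : i ∈ I₂ <;> simp [h1, h2]
  have qm : ∀ (z : Matrix ι ι ℂ) j i, (q * z) j i = if j ∈ I₂ then z j i else 0 :=
    fun z j i => by simp [hq, diagOn_mul]
  have mq : ∀ (z : Matrix ι ι ℂ) j i, (z * q) j i = if i ∈ I₂ then z j i else 0 :=
    fun z j i => by simp [hq, mul_diagOn]
  have hnil : IsNilpotent y := by
    refine isNilpotent_of_corner (p := p) (q := q) (x := x) ?_ ?_ ?_ ?_ ?_ hn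
    · ext j i
      rw [add_mul, Matrix.add_apply, pm, qm]
      by_cases j1 : j ∈ I₁
      · simp [j1, n12 j1, y1 j j1]
      · by_cases j2 : j ∈ I₂ <;> simp [j1, j2]
    · ext j i
      rw [mp, pm]
      by_cases hj : j ∈ I₁ ∨ j ∈ I₂
      · simp [hj]
      · by_cases hi : i ∈ I₁ ∨ i ∈ I₂
        · rw [if_pos hi, if_neg hj, xI i hi j (fun h => hj (Or.inl h)) fun h => hj (Or.inr h)]
        · rw [if_neg hi]
    · ext j i
      rw [pm, pm]
      by_cases hj : j ∈ I₁ ∨ j ∈ I₂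
      · simp [hj]
      · rw [if_neg hj, if_neg hj]
        rw [not_or] at hj
        by_cases hi : i ∈ I₁
        · rw [y1' i hi, xI i (Or.inl hi) j hj.1 hj.2]
        · exact yx j i hj.1 hi (Or.inl hj.2)
    · ext j i
      rw [mq, mq, qm]
      by_cases hi : i ∈ I₂
      · rw [if_pos hi, if_pos hi]
        split_ifs with hj
        · rfl
        · by_cases j1 : j ∈ I₁
          · exact (s2 i hi j j1).symm
          · exact (xI i (Or.inr hi) j j1 hj).symm
      · rw [if_neg hi, if_neg hi]
    · ext j i
      rw [mq, mq]
      by_cases hi : i ∈ I₂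
      · rw [if_pos hi, if_pos hi]
        by_cases j1 : j ∈ I₁
        · rw [s2 i hi j j1, y1 j j1]
        · exact yx j i j1 (n21 hi) (Or.inr (n2K hi))
      · rw [if_neg hi, if_neg hi]
  have hy0 : y = 0 := by
    refine h.eq_zero y (fun j i hji => ?_) (fun i j hij => ?_) hnil
    · by_cases j1 : j ∈ I₁
      · exact y1 j j1 i
      by_cases i1 : i ∈ I₁
      · exact y1' i i1 j
      by_cases h2 : j ∈ I₂ ∧ i ∈ K
      · exact absurd ((hr' j i).2 ⟨(hI j (Or.inr h2.1) i).2 (Or.inr (Or.inr h2.2)), j1, i1⟩) hji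
      · rw [yx j i j1 i1 (not_and_or.1 h2)]
        exact hx j i fun h3 => hji ((hr' j i).2 ⟨h3, j1, i1⟩)
    · obtain ⟨rij, i1, j1⟩ := (hr' i j).1 hij
      rw [Matrix.mul_apply, Matrix.mul_apply]
      by_cases i2 : i ∈ I₂
      · by_cases j2 : j ∈ I₂
        · have h1 := hFx i j rij
          rw [Gx j j1 (n2K j2), xG2 i i2] at h1
          refine Eq.trans (Finset.sum_congr rfl fun k _ => ?_)
            (h1.trans (Finset.sum_congr rfl fun k _ => ?_))
          · by_cases k2 : k ∈ I₂
            · rw [yx k i (n21 k2) i1 (Or.inr (n2K i2))]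
            · rw [F2 j j2 k k2, zero_mul, zero_mul]
          · by_cases kK : k ∈ K
            · rw [if_pos kK, y2K j j2 k kK]
            · rw [if_neg kK]
              by_cases k1 : k ∈ I₁
              · rw [F1' k k1, mul_zero, mul_zero]
              · rw [yx j k j1 k1 (Or.inr kK)]
        · have jK : j ∈ K := by
            rcases (hI i (Or.inr i2) j).1 rij with h2 | h2 | h2
            exacts [absurd h2 j1, absurd h2 j2, h2]
          -- The equation tested at `(i, j)` in the smaller algebra is the one at `(i, e.symm j)` in
          -- the larger, since row `j` of `F` on `I₂` was moved to row `e.symm j`.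
          have h1 := hFx i (e.symm j) ((hI i (Or.inr i2) _).2 (Or.inl (heK jK)))
          rw [Gx1 _ (heK jK), xG2 i i2, e.apply_symm_apply] at h1
          refine Eq.trans (Finset.sum_congr rfl fun k _ => ?_)
            (h1.trans (Finset.sum_congr rfl fun k _ => ?_))
          · by_cases k2 : k ∈ I₂
            · rw [if_pos k2, yx k i (n21 k2) i1 (Or.inr (n2K i2))]
            · rw [if_neg k2]
              by_cases k1 : k ∈ I₁
              · rw [y1 k k1, mul_zero]
              · rw [yx k i k1 i1 (Or.inl k2), xI i (Or.inr i2) k k1 k2, mul_zero]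
          · by_cases kK : k ∈ K
            · rw [if_pos kK, yx j k j1 (nK1 kK) (Or.inl j2), s1 _ (heK kK) j jK,
                e.apply_symm_apply]
            · rw [if_neg kK]
              by_cases k1 : k ∈ I₁
              · rw [F1' k k1, mul_zero, mul_zero]
              · by_cases k2 : k ∈ I₂
                · rw [s2 k k2 _ (heK jK), yx j k j1 k1 (Or.inr kK), xI k (Or.inr k2) j j1 j2]
                · rw [F2' i i2 k k2 kK, mul_zero, mul_zero]
      · have j2 : j ∉ I₂ := fun j2 => (hI' j (Or.inr j2) i rij).elim i1 i2
        have h1 := hFx i j rij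
        rw [xG i i1 i2] at h1
        have h2 : ∑ k, y j k * F k i = ∑ k, x j k * F k i := by
          refine Finset.sum_congr rfl fun k _ => ?_
          by_cases k1 : k ∈ I₁
          · rw [F1' k k1, mul_zero, mul_zero]
          · rw [yx j k j1 k1 (Or.inl j2)]
        rw [h2, ← h1]
        by_cases jK : j ∈ K
        -- The pairing term supplies exactly the contribution of `I₂` that was removed from row `j`
        -- of `F`.
        · have h3 : c * x (e.symm j) i = ∑ k, if k ∈ I₂ then F j k * y k i else 0 := by
            by_cases iK : i ∈ K
            · have h4 := s3 _ (heK iK) _ (Or.inl (heK jK))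
              rw [e.apply_symm_apply, Gx1 _ (heK jK), e.apply_symm_apply] at h4
              rw [mul_comm, ← h4]
              refine Finset.sum_congr rfl fun k _ => ?_
              by_cases k2 : k ∈ I₂
              · rw [if_pos k2, if_pos k2, y2K k k2 i iK]
              · rw [if_neg k2, if_neg k2]
            · rw [xI' _ (Or.inl (heK jK)) i i1 i2 iK, mul_zero]
              refine (Finset.sum_eq_zero fun k _ => ?_).symm
              by_cases k2 : k ∈ I₂
              · rw [if_pos k2, yx k i (n21 k2) i1 (Or.inr iK), xI' k (Or.inr k2) i i1 i2 iK,
                  mul_zero]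
              · rw [if_neg k2]
          rw [GxK j jK, h3, ← Finset.sum_add_distrib]
          refine Finset.sum_congr rfl fun k _ => ?_
          by_cases k2 : k ∈ I₂
          · rw [if_pos k2, if_pos k2, add_zero]
          · rw [if_neg k2, if_neg k2, zero_add]
            by_cases k1 : k ∈ I₁
            · rw [F1 k k1, zero_mul, zero_mul]
            · rw [yx k i k1 i1 (Or.inl k2)]
        · rw [Gx j j1 jK]
          refine Finset.sum_congr rfl fun k _ => ?_
          by_cases k1 : k ∈ I₁
          · rw [F1 k k1, zero_mul, zero_mul]
          · by_cases k2 : k ∈ I₂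
            · have : F j k = 0 := F2' k k2 j j2 jK
              rw [this, zero_mul, zero_mul]
            · rw [yx k i k1 i1 (Or.inl k2)]
  have hyz : ∀ j i, y j i = 0 := fun j i => by rw [hy0, Matrix.zero_apply]
  have z22 : ∀ j ∈ I₂, ∀ i ∈ I₂, x j i = 0 := fun j hj i hi => by
    rw [← yx j i (n21 hj) (n21 hi) (Or.inr (n2K hi)), hyz]
  have z21 : ∀ j ∈ I₂, ∀ i ∈ I₁, x j i = 0 := fun j hj i hi => by
    rw [← e.symm_apply_apply i, ← y2K j hj _ ((he i).2 hi), hyz]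
  -- These entries do not appear in `y`; the pairing expresses them through the `I₂ × I₁` entries,
  -- already zero.
  have zIK : ∀ j, j ∈ I₁ ∨ j ∈ I₂ → ∀ i ∈ K, x j i = 0 := by
    intro j hj i hi
    have h1 := s3 _ (heK hi) j hj
    have h2 : (G * x) j (e.symm i) = 0 := by
      rcases hj with hj | hj
      · rw [Gx1 j hj]
        refine Finset.sum_eq_zero fun k _ => ?_
        split_ifs with k2
        · rw [z21 k k2 _ (heK hi), mul_zero]
        · rfl
      · rw [Gx j (n21 hj) (n2K hj)]
        refine Finset.sum_eq_zero fun k _ => ?_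
        by_cases k2 : k ∈ I₂
        · rw [z21 k k2 _ (heK hi), mul_zero]
        · rw [F2 j hj k k2, zero_mul]
    rw [h2, e.apply_symm_apply] at h1
    exact (mul_eq_zero.1 h1.symm).resolve_right hc
  ext j i
  rw [Matrix.zero_apply]
  by_cases hj : j ∈ I₁ ∨ j ∈ I₂
  · by_cases iK : i ∈ K
    · exact zIK j hj i iK
    by_cases i2 : i ∈ I₂
    · exact hj.elim (fun h => s2 i i2 j h) fun h => z22 j h i i2
    by_cases i1 : i ∈ I₁
    · rcases hj with hj | hj
      · have := s1 i i1 (e j) ((he j).2 hj)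
        rw [e.symm_apply_apply] at this
        have h1K := (he j).2 hj
        rw [this, ← yx _ _ (nK1 h1K) (nK1 ((he i).2 i1)) (Or.inl (nK2 h1K)), hyz]
      · exact z21 j hj i i1
    · exact xI' j hj i i1 i2 iK
  · rw [not_or] at hj
    by_cases hi : i ∈ I₁ ∨ i ∈ I₂
    · exact xI i hi j hj.1 hj.2
    · rw [not_or] at hi
      rw [← yx j i hj.1 hi.1 (Or.inl hj.2), hyz]

end ShiftBlock

/-! ### Palindromic seaweeds, skew forms and the base cases -/

section Palindromic

/-- Two positions lie in the same block of the palindromic block structure with outer block sizes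
`c₁, c₂, …`, occupying the positions `s, …, N - s - 1`. -/
def MirrorBlock (N : ℕ) : List ℕ → ℕ → ℕ → ℕ → Prop
  | [], s, i, j => s ≤ i ∧ i + s < N ∧ s ≤ j ∧ j + s < N
  | c :: cs, s, i, j => (s ≤ i ∧ i < s + c ∧ s ≤ j ∧ j < s + c) ∨
      (N ≤ i + s + c ∧ i + s < N ∧ N ≤ j + s + c ∧ j + s < N) ∨ MirrorBlock N cs (s + c) i j

theorem MirrorBlock.bounds {n : ℕ} {c : List ℕ} {s i j : ℕ} (hs : s + c.sum ≤ n)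
    (h : MirrorBlock (2 * n) c s i j) : s ≤ i ∧ i + s < 2 * n ∧ s ≤ j ∧ j + s < 2 * n := by
  induction c generalizing s with
  | nil => exact h
  | cons c cs ih =>
    rw [List.sum_cons] at hs
    rcases h with h | h | h
    · omega
    · omega
    · have := ih (by omega) h
      omega

theorem MirrorBlock.symm {N : ℕ} {c : List ℕ} {s i j : ℕ} (h : MirrorBlock N c s i j) :
    MirrorBlock N c s j i := by
  induction c generalizing s with
  | nil =>
    obtain ⟨a, b, c, d⟩ := h
    exact ⟨c, d, a, b⟩
  | cons c cs ih =>
    rcases h with ⟨a, b, c, d⟩ | ⟨a, b, c, d⟩ | h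
    · exact Or.inl ⟨c, d, a, b⟩
    · exact Or.inr (Or.inl ⟨c, d, a, b⟩)
    · exact Or.inr (Or.inr (ih h))

theorem mirrorBlock_zero_cons {n : ℕ} {c : List ℕ} {s i j : ℕ} :
    MirrorBlock (2 * n) (0 :: c) s i j ↔ MirrorBlock (2 * n) c s i j := by
  refine ⟨?_, fun h => Or.inr (Or.inr h)⟩
  rintro (h | h | h)
  · omega
  · omega
  · exact h

/-- The support of the palindromic seaweed algebra with lower blocks `a` and upper blocks `b`,
occupying the positions `s, …, 2n - s - 1`. -/
def mirrorRel (n : ℕ) (a b : List ℕ) (s : ℕ) (i j : Fin (2 * n)) : Prop :=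
  (j.val ≤ i.val ∧ MirrorBlock (2 * n) a s i j) ∨ (i.val ≤ j.val ∧ MirrorBlock (2 * n) b s i j)

/-- The sign of a basis vector with respect to the anti-diagonal symplectic form. -/
def halfSign (n : ℕ) (i : Fin (2 * n)) : ℂ := if i.val < n then 1 else -1

/-- The matrix represents a one-form which changes sign under the anti-involution attached to the
anti-diagonal symplectic form. -/
def IsSkew {n : ℕ} (F : Matrix (Fin (2 * n)) (Fin (2 * n)) ℂ) : Prop :=
  ∀ i j, F i j = -(halfSign n i * halfSign n j) * F j.rev i.rev

theorem IsSkew.add {n : ℕ} {F G : Matrix (Fin (2 * n)) (Fin (2 * n)) ℂ} (hF : IsSkew F)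
    (hG : IsSkew G) : IsSkew (F + G) := fun i j => by
  rw [Matrix.add_apply, Matrix.add_apply, hF i j, hG i j, mul_add]

theorem IsSkew.transpose {n : ℕ} {F : Matrix (Fin (2 * n)) (Fin (2 * n)) ℂ} (hF : IsSkew F) :
    IsSkew F.transpose := fun i j => by
  rw [Matrix.transpose_apply, Matrix.transpose_apply, hF j i, mul_comm (halfSign n j)]

/-- The entries `2 * i + 1 - 2 * n` change sign under `i ↦ i.rev`; as they are also distinct, they
give regular diagonal forms inside `sp(2n)`. -/
theorem isSkew_diagOn {n : ℕ} {I : Set (Fin (2 * n))} (hI : ∀ i, i.rev ∈ I ↔ i ∈ I) :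
    IsSkew (diagOn I fun i => 2 * (i.val : ℂ) + 1 - 2 * n) := by
  classical
  intro i j
  rw [diagOn, Matrix.diagonal_apply, Matrix.diagonal_apply]
  by_cases h : i = j
  · subst h
    rw [if_pos rfl, if_pos rfl]
    simp only [hI]
    split_ifs
    · rw [Fin.val_rev]
      have : ((2 * n - (i.val + 1) : ℕ) : ℂ) = 2 * n - i.val - 1 := by
        have := i.2
        rw [Nat.cast_sub (by omega)]
        push_cast
        ring
      rw [this]
      unfold halfSign
      split_ifs <;> ring
    · simp
  · rw [if_neg h, if_neg fun h' => h (Fin.rev_injective h').symm, mul_zero]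

/-- Cyclic translation by `t`. -/
def shiftPerm (N t : ℕ) (h : t ≤ N) : Equiv.Perm (Fin N) where
  toFun i := ⟨if i.val + t < N then i.val + t else i.val + t - N, by split_ifs <;> omega⟩
  invFun i := ⟨if t ≤ i.val then i.val - t else i.val + N - t, by split_ifs <;> omega⟩
  left_inv i := by
    ext
    have := i.2
    simp only
    split_ifs <;> omega
  right_inv i := by
    ext
    have := i.2
    simp only
    split_ifs <;> omega

theorem val_shiftPerm {N t : ℕ} {h : t ≤ N} (i : Fin N) : (shiftPerm N t h i).val =
    if i.val + t < N then i.val + t else i.val + t - N := rfl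

theorem val_shiftPerm_symm {N t : ℕ} {h : t ≤ N} (i : Fin N) : ((shiftPerm N t h).symm i).val =
    if t ≤ i.val then i.val - t else i.val + N - t := rfl

/-- There is a skew one-form on the palindromic seaweed whose stabilizer has no nonzero
nilpotents. -/
def HasSkewForm (n : ℕ) (a b : List ℕ) (s : ℕ) : Prop :=
  ∃ F : Matrix (Fin (2 * n)) (Fin (2 * n)) ℂ, NilFree (mirrorRel n a b s) F ∧ IsSkew F

/-- Transposition interchanges lower and upper blocks and preserves nilpotency and skewness. -/
theorem HasSkewForm.swap {n : ℕ} {a b : List ℕ} {s : ℕ} (h : HasSkewForm n a b s) :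
    HasSkewForm n b a s := by
  obtain ⟨F, hF, hs⟩ := h
  refine ⟨F.transpose, ?_, hs.transpose⟩
  convert hF.transpose using 3 with i j
  unfold mirrorRel
  constructor <;>
    exact fun h => h.elim (fun h => Or.inr ⟨h.1, h.2.symm⟩) fun h => Or.inl ⟨h.1, h.2.symm⟩

theorem injective_diagonalEntry (n : ℕ) :
    Function.Injective fun i : Fin (2 * n) => 2 * (i.val : ℂ) + 1 - 2 * n := fun i j hij => by
  have hij : 2 * (i.val : ℂ) + 1 - 2 * n = 2 * (j.val : ℂ) + 1 - 2 * n := hij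
  have : (i.val : ℂ) = j.val := by linear_combination hij / 2
  exact Fin.ext (Nat.cast_injective this)

theorem hasSkewForm_nil_nil (n s : ℕ) : HasSkewForm n [] [] s := by
  have h0 : NilFree (fun _ _ : Fin (2 * n) => False) 0 :=
    ⟨fun _ _ _ => rfl, fun x hx _ _ => Matrix.ext fun i j => hx i j id⟩
  refine ⟨_, h0.add_block (I := {i | s ≤ i.val ∧ i.val + s < 2 * n})
    (d := fun i => 2 * (i.val : ℂ) + 1 - 2 * n) (fun _ _ h => h.elim) (fun i j => ?_) ?_, ?_⟩
  · simp only [mirrorRel, MirrorBlock, Set.mem_ofPred_eq, or_false]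
    omega
  · exact (injective_diagonalEntry n).injOn
  · rw [zero_add]
    refine isSkew_diagOn fun i => ?_
    have := i.2
    simp only [Set.mem_ofPred_eq, Fin.val_rev]
    omega

theorem diagOn_add {ι : Type*} [Fintype ι] [DecidableEq ι] (I : Set ι) (d d' : ι → ℂ) :
    diagOn I d + diagOn I d' = diagOn I (d + d') := by
  ext i j
  simp only [diagOn, Matrix.add_apply, Matrix.diagonal_apply]
  split_ifs <;> simp

theorem diagOn_union {ι : Type*} [Fintype ι] [DecidableEq ι] {I K : Set ι} (h : Disjoint I K)
    (d : ι → ℂ) : diagOn (I ∪ K) d = diagOn I d + diagOn K d := by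
  ext i j
  rw [Matrix.add_apply, diagOn, diagOn, diagOn, Matrix.diagonal_apply, Matrix.diagonal_apply,
    Matrix.diagonal_apply]
  by_cases hI : i ∈ I
  · have hK := Set.disjoint_left.1 h hI
    split_ifs <;> simp_all
  · split_ifs <;> simp_all

/-- The upper side is a single central block, so the first lower block `I` is paired with its own
mirror image `K`. A full matrix algebra on `K` then remains and needs a regular diagonal form; to
keep the total skew, this form is shared between `I` and `K` through the parameter `d`. -/
theorem hasSkewForm_cons_nil {n a₁ s : ℕ} {a : List ℕ} (hs : s + (a₁ :: a).sum ≤ n)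
    (h : HasSkewForm n a [] (s + a₁)) : HasSkewForm n (a₁ :: a) [] s := by
  obtain ⟨F, hF, hsk⟩ := h
  rw [List.sum_cons] at hs
  set I : Set (Fin (2 * n)) := {i | s ≤ i.val ∧ i.val < s + a₁} with hI
  set K : Set (Fin (2 * n)) := {i | 2 * n ≤ i.val + s + a₁ ∧ i.val + s < 2 * n} with hK
  set J : Set (Fin (2 * n)) := {i | s + a₁ ≤ i.val ∧ i.val + s + a₁ < 2 * n} with hJ
  set e := shiftPerm (2 * n) (2 * n - 2 * s - a₁) (by omega) with he
  set g : Fin (2 * n) → ℂ := fun i => 2 * (i.val : ℂ) + 1 - 2 * n with hg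
  have hb : ∀ i j : Fin (2 * n), MirrorBlock (2 * n) a (s + a₁) i j →
      s + a₁ ≤ i.val ∧ i.val + (s + a₁) < 2 * n ∧ s + a₁ ≤ j.val ∧ j.val + (s + a₁) < 2 * n :=
    fun i j => MirrorBlock.bounds (by omega)
  have hmem : ∀ i : Fin (2 * n), (i ∈ I ↔ s ≤ i.val ∧ i.val < s + a₁) ∧
      (i ∈ J ↔ s + a₁ ≤ i.val ∧ i.val + s + a₁ < 2 * n) ∧
      (i ∈ K ↔ 2 * n ≤ i.val + s + a₁ ∧ i.val + s < 2 * n) := fun i => ⟨Iff.rfl, Iff.rfl, Iff.rfl⟩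
  have hmI := fun i => (hmem i).1
  have hmJ := fun i => (hmem i).2.1
  have hmK := fun i => (hmem i).2.2
  clear_value I J K
  have h1 : NilFree (fun i j => (i ∈ K ∧ j ∈ K) ∨ mirrorRel n a [] (s + a₁) i j)
      (F + diagOn K (g + g ∘ e.symm)) := by
    refine hF.add_block (fun i j hij => ?_) (fun i j => Iff.rfl) ?_
    · rw [hmK, hmK]
      rcases hij with hij | hij
      · have := hb _ _ hij.2
        omega
      · have := hij.2
        simp only [MirrorBlock] at this
        omega
    -- On `K` the entries of `g + g ∘ e.symm` are `4 * i` plus a constant.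
    · intro i hi j hj hij
      rw [hmK] at hi hj
      have e1 : ∀ i : Fin (2 * n), i ∈ K →
          ((e.symm i).val : ℂ) = i.val - ((2 * n - 2 * s - a₁ : ℕ) : ℂ) := fun i hi => by
        rw [hmK] at hi
        rw [he, val_shiftPerm_symm, if_pos (by omega), Nat.cast_sub (by omega)]
      simp only [Pi.add_apply, Function.comp_apply, hg] at hij
      rw [e1 i ((hmK i).2 hi), e1 j ((hmK j).2 hj)] at hij
      have : (i.val : ℂ) = j.val := by linear_combination hij / 4
      exact Fin.ext (Nat.cast_injective this)
  rw [← diagOn_add, ← add_assoc] at h1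
  refine ⟨_, NilFree.pair_block (I := I) (J := J) (K := K) (e := e) (c := 1) one_ne_zero
    ?_ ?_ ?_ ?_ ?_ ?_ ?_ ?_ (Or.inr ?_) ?_ h1, ?_⟩
  · intro i
    rw [hmI, hmK, he, val_shiftPerm]
    have := i.2
    split_ifs <;> omega
  · rw [Set.disjoint_left]
    intro i
    rw [hmI, hmK]
    omega
  · intro i hi j
    have := hb i j
    simp only [hmI, hmJ, hmK, mirrorRel, MirrorBlock] at hi ⊢
    by_cases hp : MirrorBlock (2 * n) a (s + a₁) i j
    · have := this hp; omega
    · simp only [hp, or_false]; omega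
  · intro i hi j
    have := hb j i
    simp only [hmI, mirrorRel, MirrorBlock] at hi ⊢
    by_cases hp : MirrorBlock (2 * n) a (s + a₁) j i
    · have := this hp; omega
    · simp only [hp, or_false]; omega
  · rw [Set.disjoint_left]
    intro i
    rw [hmI, hmJ]
    omega
  · rw [Set.disjoint_left]
    intro i
    rw [hmJ, hmK]
    omega
  · intro i hi j hj
    rw [hmJ] at hi
    rw [hmK] at hj
    simp only [mirrorRel, MirrorBlock]
    omega
  · intro i j
    have := hb i j
    simp only [hmI, hmJ, hmK, mirrorRel, MirrorBlock]
    by_cases hp : MirrorBlock (2 * n) a (s + a₁) i j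
    · have := this hp
      simp only [hp, or_true, and_true]
      omega
    · simp only [hp, or_false, and_false, false_or]; omega
  · intro i j
    have := hb i j
    simp only [hmK, mirrorRel, MirrorBlock]
    by_cases hp : MirrorBlock (2 * n) a (s + a₁) i j
    · have := this hp; omega
    · simp only [hp, and_false, false_or]; omega
  · intro i j hij
    rw [not_or] at hij
    rw [Matrix.add_apply, hF.supp i j hij.2, zero_add, diagOn, Matrix.diagonal_apply]
    split_ifs with h2 h3
    · exact absurd ⟨h2 ▸ h3, h3⟩ hij.1
    · rfl
    · rfl
  · have hIK : Disjoint I K := by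
      rw [Set.disjoint_left]
      intro i
      rw [hmI, hmK]
      omega
    have : F + diagOn K g + shiftOn I e 1 + diagOn I g =
        F + diagOn (I ∪ K) g + shiftOn I e 1 := by
      rw [diagOn_union hIK]; abel
    rw [this]
    refine (hsk.add (isSkew_diagOn fun i => ?_)).add fun j i => ?_
    · rw [Set.mem_union, Set.mem_union, hmI, hmI, hmK, hmK, Fin.val_rev]
      have := i.2
      omega
    -- Reversal permutes the positions `(e i, i)`, and each joins opposite halves, so the constant
    -- coefficient 1 is skew.
    · simp only [shiftOn, Matrix.of_apply, hmI, Fin.ext_iff, Fin.val_rev, he, val_shiftPerm]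
      have hi := i.2
      have hj := j.2
      by_cases h2 : (s ≤ i.val ∧ i.val < s + a₁) ∧ j.val = i.val + (2 * n - 2 * s - a₁)
      · rw [if_pos (by split_ifs <;> omega), if_pos (by split_ifs <;> omega), halfSign, halfSign,
          if_neg (by omega), if_pos (by omega)]
        norm_num
      · rw [if_neg (by split_ifs <;> omega), if_neg (by split_ifs <;> omega), mul_zero]

/-- Equal outer blocks are full matrix algebras on `I` and its mirror image `K`, independent of the
rest; regular diagonal forms on the two are jointly skew. -/
theorem hasSkewForm_cons_cons_eq {n a₁ s : ℕ} {a b : List ℕ} (hs : s + (a₁ :: a).sum ≤ n)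
    (hs' : s + (a₁ :: b).sum ≤ n)
    (h : HasSkewForm n a b (s + a₁)) : HasSkewForm n (a₁ :: a) (a₁ :: b) s := by
  obtain ⟨F, hF, hsk⟩ := h
  rw [List.sum_cons] at hs hs'
  set I : Set (Fin (2 * n)) := {i | s ≤ i.val ∧ i.val < s + a₁} with hI
  set K : Set (Fin (2 * n)) := {i | 2 * n ≤ i.val + s + a₁ ∧ i.val + s < 2 * n} with hK
  set g : Fin (2 * n) → ℂ := fun i => 2 * (i.val : ℂ) + 1 - 2 * n with hg
  have hb : ∀ i j, mirrorRel n a b (s + a₁) i j →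
      s + a₁ ≤ i.val ∧ i.val + (s + a₁) < 2 * n ∧ s + a₁ ≤ j.val ∧ j.val + (s + a₁) < 2 * n :=
    fun i j h => h.elim (fun h => MirrorBlock.bounds (by omega) h.2)
      fun h => MirrorBlock.bounds (by omega) h.2
  have h1 : NilFree (fun i j => (i ∈ K ∧ j ∈ K) ∨ mirrorRel n a b (s + a₁) i j)
      (F + diagOn K g) := by
    refine hF.add_block (fun i j hij => ?_) (fun i j => Iff.rfl)
      (injective_diagonalEntry n).injOn
    have := hb _ _ hij
    simp only [hK, Set.mem_ofPred_eq]
    omega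
  refine ⟨_, h1.add_block (I := I) (d := g) (fun i j hij => ?_) (fun i j => ?_)
    (injective_diagonalEntry n).injOn, ?_⟩
  · rcases hij with hij | hij
    · simp only [hI, hK, Set.mem_ofPred_eq] at hij ⊢
      omega
    · have := hb _ _ hij
      simp only [hI, Set.mem_ofPred_eq]
      omega
  · simp only [hI, hK, Set.mem_ofPred_eq, mirrorRel, MirrorBlock]
    by_cases hp : MirrorBlock (2 * n) a (s + a₁) i j <;>
      by_cases hq : MirrorBlock (2 * n) b (s + a₁) i j <;>
      simp only [hp, hq, or_false, false_or, or_true, and_true, and_false] <;> omega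
  · have hIK : Disjoint K I := by
      rw [Set.disjoint_left]
      intro i
      simp only [hI, hK, Set.mem_ofPred_eq]
      omega
    rw [add_assoc, ← diagOn_union hIK]
    refine hsk.add (isSkew_diagOn fun i => ?_)
    simp only [hI, hK, Set.mem_union, Set.mem_ofPred_eq, Fin.val_rev]
    have := i.2
    omega

end Palindromic

/-! ### Panyushev's reduction at both ends of a palindrome -/

section Reductions

theorem diagOn_zero {ι : Type*} [Fintype ι] [DecidableEq ι] (I : Set ι) :
    diagOn I (0 : ι → ℂ) = 0 := by
  simp [diagOn]

/-- Encodes an opaque proposition as an equation, so that `omega` can reason about it. -/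
theorem exists_nat_eq_one_iff (P : Prop) : ∃ p : ℕ, P ↔ p = 1 := by
  by_cases h : P
  · exact ⟨1, by simp [h]⟩
  · exact ⟨0, by simp [h]⟩

/-- `NilFree.pair_block` is applied at each end, the last block being a first block of the
transposed algebra. Reversal exchanges the two pairings, each inside one half, which forces the
opposite coefficients `1` and `-1`. -/
theorem hasSkewForm_of_two_mul_le {n a₁ c s : ℕ} {a b : List ℕ}
    (hs : s + (a₁ :: a).sum ≤ n) (hs' : s + ((2 * a₁ + c) :: b).sum ≤ n)
    (h : HasSkewForm n a (c :: a₁ :: b) (s + a₁)) :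
    HasSkewForm n (a₁ :: a) ((2 * a₁ + c) :: b) s := by
  obtain ⟨F, hF, hsk⟩ := h
  rw [List.sum_cons] at hs hs'
  have e1 : s + a₁ + c + a₁ = s + (2 * a₁ + c) := by omega
  set I : Set (Fin (2 * n)) := {i | s ≤ i.val ∧ i.val < s + a₁} with hI
  set J : Set (Fin (2 * n)) := {i | s + a₁ ≤ i.val ∧ i.val < s + a₁ + c} with hJ
  set K : Set (Fin (2 * n)) := {i | s + a₁ + c ≤ i.val ∧ i.val < s + (2 * a₁ + c)} with hK
  set I' : Set (Fin (2 * n)) := {i | 2 * n ≤ i.val + s + a₁ ∧ i.val + s < 2 * n} with hI'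
  set J' : Set (Fin (2 * n)) := {i | 2 * n ≤ i.val + s + a₁ + c ∧ i.val + s + a₁ < 2 * n} with hJ'
  set K' : Set (Fin (2 * n)) :=
      {i | 2 * n ≤ i.val + s + (2 * a₁ + c) ∧ i.val + s + a₁ + c < 2 * n} with hK'
  have hb : ∀ i j : Fin (2 * n), MirrorBlock (2 * n) a (s + a₁) i j →
      s + a₁ ≤ i.val ∧ i.val + (s + a₁) < 2 * n ∧ s + a₁ ≤ j.val ∧ j.val + (s + a₁) < 2 * n :=
    fun i j => MirrorBlock.bounds (by omega)
  have hb' : ∀ i j : Fin (2 * n), MirrorBlock (2 * n) b (s + (2 * a₁ + c)) i j →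
      s + (2 * a₁ + c) ≤ i.val ∧ i.val + (s + (2 * a₁ + c)) < 2 * n ∧ s + (2 * a₁ + c) ≤ j.val ∧
        j.val + (s + (2 * a₁ + c)) < 2 * n :=
    fun i j => MirrorBlock.bounds (by omega)
  set e := shiftPerm (2 * n) (a₁ + c) (by omega) with he
  have hmI : ∀ i, i ∈ I ↔ s ≤ i.val ∧ i.val < s + a₁ := fun _ => Iff.rfl
  have hmJ : ∀ i, i ∈ J ↔ s + a₁ ≤ i.val ∧ i.val < s + a₁ + c := fun _ => Iff.rfl
  have hmK : ∀ i, i ∈ K ↔ s + a₁ + c ≤ i.val ∧ i.val < s + (2 * a₁ + c) := fun _ => Iff.rfl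
  have hmI' : ∀ i, i ∈ I' ↔ 2 * n ≤ i.val + s + a₁ ∧ i.val + s < 2 * n := fun _ => Iff.rfl
  have hmJ' : ∀ i, i ∈ J' ↔ 2 * n ≤ i.val + s + a₁ + c ∧ i.val + s + a₁ < 2 * n := fun _ => Iff.rfl
  have hmK' : ∀ i, i ∈ K' ↔ 2 * n ≤ i.val + s + (2 * a₁ + c) ∧ i.val + s + a₁ + c < 2 * n :=
      fun _ => Iff.rfl
  clear_value I J K I' J' K'
  set r : Fin (2 * n) → Fin (2 * n) → Prop := mirrorRel n (a₁ :: a) ((2 * a₁ + c) :: b) s with hr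
  set r₂ := mirrorRel n a (c :: a₁ :: b) (s + a₁) with hr₂
  set r₁ : Fin (2 * n) → Fin (2 * n) → Prop := fun i j => r i j ∧ i ∉ I ∧ ¬ (i ∈ J ∧ j ∈ K) with hr₁
  -- Both supports in linear arithmetic, with the inner blocks reduced to `p = 1` and `q = 1` and
  -- their bounds; the combinatorial hypotheses of the reduction then fall to `omega`.
  have hkey : ∀ i j : Fin (2 * n), ∃ p q : ℕ,
      (p = 1 → s + a₁ ≤ i.val ∧ i.val + (s + a₁) < 2 * n ∧ s + a₁ ≤ j.val ∧
        j.val + (s + a₁) < 2 * n) ∧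
      (q = 1 → s + (2 * a₁ + c) ≤ i.val ∧ i.val + (s + (2 * a₁ + c)) < 2 * n ∧
        s + (2 * a₁ + c) ≤ j.val ∧
        j.val + (s + (2 * a₁ + c)) < 2 * n) ∧
      (r i j ↔ (j.val ≤ i.val ∧ ((s ≤ i.val ∧ i.val < s + a₁ ∧ s ≤ j.val ∧ j.val < s + a₁) ∨
          (2 * n ≤ i.val + s + a₁ ∧ i.val + s < 2 * n ∧ 2 * n ≤ j.val + s + a₁ ∧
            j.val + s < 2 * n) ∨ p = 1)) ∨
        (i.val ≤ j.val ∧ ((s ≤ i.val ∧ i.val < s + (2 * a₁ + c) ∧ s ≤ j.val ∧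
          j.val < s + (2 * a₁ + c)) ∨
          (2 * n ≤ i.val + s + (2 * a₁ + c) ∧ i.val + s < 2 * n ∧ 2 * n ≤ j.val + s + (2 * a₁ + c) ∧
            j.val + s < 2 * n) ∨ q = 1))) ∧
      (r₂ i j ↔ (j.val ≤ i.val ∧ p = 1) ∨
        (i.val ≤ j.val ∧ ((s + a₁ ≤ i.val ∧ i.val < s + a₁ + c ∧ s + a₁ ≤ j.val ∧
            j.val < s + a₁ + c) ∨
          (2 * n ≤ i.val + (s + a₁) + c ∧ i.val + (s + a₁) < 2 * n ∧
            2 * n ≤ j.val + (s + a₁) + c ∧ j.val + (s + a₁) < 2 * n) ∨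
          (s + a₁ + c ≤ i.val ∧ i.val < s + (2 * a₁ + c) ∧ s + a₁ + c ≤ j.val ∧
            j.val < s + (2 * a₁ + c)) ∨
          (2 * n ≤ i.val + (s + a₁ + c) + a₁ ∧
            i.val + (s + a₁ + c) < 2 * n ∧
            2 * n ≤ j.val + (s + a₁ + c) + a₁ ∧
            j.val + (s + a₁ + c) < 2 * n) ∨ q = 1))) := by
    intro i j
    obtain ⟨p, hp⟩ := exists_nat_eq_one_iff (MirrorBlock (2 * n) a (s + a₁) i j)
    obtain ⟨q, hq⟩ := exists_nat_eq_one_iff (MirrorBlock (2 * n) b (s + (2 * a₁ + c)) i j)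
    refine ⟨p, q, fun h => hb i j (hp.2 h), fun h => hb' i j (hq.2 h), ?_, ?_⟩
    · simp only [hr, mirrorRel, MirrorBlock, hp, hq]
    · simp only [hr₂, mirrorRel, MirrorBlock, hp, hq, e1]
  -- removal of the last block, seen in the transposed algebra
  have h1 : NilFree (fun j i => r₁ i j) (F.transpose + shiftOn I' e.symm (-1)) := by
    have := NilFree.pair_block (r := fun j i => r₁ i j) (r' := fun j i => r₂ i j)
      (F := F.transpose) (I := I') (J := J') (K := K') (e := e.symm) (c := -1) (d := 0)
      (by norm_num) ?_ ?_ ?_ ?_ ?_ ?_ ?_ ?_ (Or.inl fun _ => rfl) hF.transpose.supp ?_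
    · rwa [diagOn_zero, add_zero] at this
    · intro i
      rw [hmI', hmK', he, val_shiftPerm_symm]
      have := i.2
      split_ifs <;> omega
    · rw [Set.disjoint_left]
      intro i
      rw [hmI', hmK']
      omega
    · intro j hj i
      obtain ⟨p, q, h1, h2, h3, -⟩ := hkey i j
      simp only [hr₁, h3, hmI, hmJ, hmK, hmI', hmJ', hmK'] at *
      omega
    · intro j hj i
      obtain ⟨p, q, h1, h2, h3, -⟩ := hkey j i
      simp only [hr₁, h3, hmI, hmJ, hmK, hmI'] at *
      omega
    · rw [Set.disjoint_left]
      intro i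
      rw [hmI', hmJ']
      omega
    · rw [Set.disjoint_left]
      intro i
      rw [hmJ', hmK']
      omega
    · intro j hj i hi
      obtain ⟨p, q, h1, h2, h3, -⟩ := hkey i j
      simp only [hr₁, h3, hmI, hmJ, hmK, hmJ', hmK'] at *
      omega
    · intro j i
      obtain ⟨p, q, h1, h2, h3, h4⟩ := hkey i j
      simp only [hr₁, h3, h4, hmI, hmJ, hmK, hmI', hmJ', hmK']
      omega
    · rw [Pi.zero_comp, diagOn_zero, add_zero]
      exact hF.transpose
  have h2 : NilFree r (F + (shiftOn I' e.symm (-1)).transpose + shiftOn I e 1) := by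
    have h1' := h1.transpose
    rw [Matrix.transpose_add, Matrix.transpose_transpose] at h1'
    have := NilFree.pair_block (r := r) (r' := r₁)
      (F := F + (shiftOn I' e.symm (-1)).transpose) (I := I) (J := J) (K := K) (e := e) (c := 1)
      (d := 0) one_ne_zero ?_ ?_ ?_ ?_ ?_ ?_ ?_ (fun _ _ => Iff.rfl) (Or.inl fun _ => rfl)
      h1'.supp ?_
    · rwa [diagOn_zero, add_zero] at this
    · intro i
      rw [hmI, hmK, he, val_shiftPerm]
      have := i.2
      split_ifs <;> omega
    · rw [Set.disjoint_left]
      intro i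
      rw [hmI, hmK]
      omega
    · intro i hi j
      obtain ⟨p, q, h1, h2, h3, -⟩ := hkey i j
      simp only [h3, hmI, hmJ, hmK] at *
      omega
    · intro i hi j
      obtain ⟨p, q, h1, h2, h3, -⟩ := hkey j i
      simp only [h3, hmI] at *
      omega
    · rw [Set.disjoint_left]
      intro i
      rw [hmI, hmJ]
      omega
    · rw [Set.disjoint_left]
      intro i
      rw [hmJ, hmK]
      omega
    · intro i hi j hj
      obtain ⟨p, q, h1, h2, h3, -⟩ := hkey i j
      simp only [h3, hmJ, hmK] at *
      omega
    · rw [Pi.zero_comp, diagOn_zero, add_zero]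
      exact h1'
  refine ⟨_, h2, ?_⟩
  rw [add_assoc]
  refine hsk.add fun j i => ?_
  have hi := i.2
  have hj := j.2
  simp only [shiftOn, Matrix.add_apply, Matrix.transpose_apply, Matrix.of_apply, hmI, hmI',
    Fin.ext_iff, Fin.val_rev, he, val_shiftPerm, val_shiftPerm_symm]
  by_cases c1 : (s ≤ i.val ∧ i.val < s + a₁) ∧ j.val = i.val + (a₁ + c)
  · rw [if_neg (by split_ifs <;> omega), if_pos (by split_ifs <;> omega),
      if_pos (by split_ifs <;> omega), if_neg (by split_ifs <;> omega), halfSign, halfSign,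
      if_pos (by omega), if_pos (by omega)]
    norm_num
  · by_cases c2 : (2 * n ≤ j.val + s + a₁ ∧ j.val + s < 2 * n) ∧ i.val + (a₁ + c) = j.val
    · rw [if_pos (by split_ifs <;> omega), if_neg (by split_ifs <;> omega),
        if_neg (by split_ifs <;> omega), if_pos (by split_ifs <;> omega), halfSign, halfSign,
        if_neg (by omega), if_neg (by omega)]
      norm_num
    · rw [if_neg (by split_ifs <;> omega), if_neg (by split_ifs <;> omega),
        if_neg (by split_ifs <;> omega), if_neg (by split_ifs <;> omega), add_zero, mul_zero]

/-- The two moves are mirror images with opposite coefficients, and `e` translates within one half,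
so relocated entries keep their sign. -/
theorem isSkew_moveOn {n c d s : ℕ} (hs : s + (2 * c + d) ≤ n)
    {F : Matrix (Fin (2 * n)) (Fin (2 * n)) ℂ} (hsk : IsSkew F)
    {I₁ I₂ K I₁' I₂' K' : Set (Fin (2 * n))}
    (hm1 : ∀ i, i ∈ I₁ ↔ s ≤ i.val ∧ i.val < s + c)
    (hm2 : ∀ i, i ∈ I₂ ↔ s + c ≤ i.val ∧ i.val < s + (c + d))
    (hmK : ∀ i, i ∈ K ↔ s + (c + d) ≤ i.val ∧ i.val < s + (2 * c + d))
    (hm1' : ∀ i, i ∈ I₁' ↔ 2 * n ≤ i.val + s + c ∧ i.val + s < 2 * n)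
    (hm2' : ∀ i, i ∈ I₂' ↔ 2 * n ≤ i.val + s + (c + d) ∧ i.val + s + c < 2 * n)
    (hmK' : ∀ i, i ∈ K' ↔ 2 * n ≤ i.val + s + (2 * c + d) ∧ i.val + s + (c + d) < 2 * n)
    {e : Equiv.Perm (Fin (2 * n))} (he : e = shiftPerm (2 * n) (c + d) (by omega)) :
    IsSkew (moveOn I₁ I₂ K e 1 (moveOn I₁' I₂' K' e.symm (-1) F.transpose).transpose) := by
  classical
  set G := moveOn I₁ I₂ K e 1 (moveOn I₁' I₂' K' e.symm (-1) F.transpose).transpose with hGdef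
  have heK : ∀ i, i ∈ I₁ → (e i).val = i.val + (c + d) := fun i hi => by
    rw [hm1] at hi
    rw [he, val_shiftPerm, if_pos (by omega)]
  have heK' : ∀ i, i ∈ I₁' → (e.symm i).val = i.val - (c + d) := fun i hi => by
    rw [hm1'] at hi
    rw [he, val_shiftPerm_symm, if_pos (by omega)]
  -- The entries relocated by the outer move lie in rows `K`, which avoid `I₁'` and `I₂'` and so
  -- were not altered by the inner move.
  have hG : ∀ j i, G j i = if i ∈ I₂ ∧ j ∈ K then 0 else if i ∈ I₂ ∧ j ∈ I₁ then F (e j) i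
      else if i ∈ I₁ then (if j = e i then 1 else 0)
      else if j ∈ I₂' ∧ i ∈ K' then 0 else if j ∈ I₂' ∧ i ∈ I₁' then F j (e.symm i)
      else if j ∈ I₁' then (if i = e.symm j then -1 else 0) else F j i := by
    intro j i
    simp only [hGdef, moveOn, Matrix.transpose_apply, Matrix.of_apply]
    by_cases i2 : i ∈ I₂
    · have n1 : i ∉ I₁ := by rw [hm1]; rw [hm2] at i2; omega
      have n2 : i ∉ K' := by rw [hmK']; rw [hm2] at i2; omega
      have n3 : i ∉ I₁' := by rw [hm1']; rw [hm2] at i2; omega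
      by_cases j1 : j ∈ I₁
      · have h3 := heK j j1
        have n4 : e j ∉ I₂' := by rw [hm2', h3]; rw [hm1] at j1; omega
        have n5 : e j ∉ I₁' := by rw [hm1', h3]; rw [hm1] at j1; omega
        have n6 : j ∉ K := by rw [hmK]; rw [hm1] at j1; omega
        simp [i2, j1, n4, n5, n6]
      · by_cases j2 : j ∈ I₂'
        · have n4 : j ∉ I₁' := by rw [hm1']; rw [hm2'] at j2; omega
          simp [i2, j1, n1, n2, n3, n4]
        · simp [i2, j1, j2, n1, n2, n3]
    · by_cases i1 : i ∈ I₁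
      · simp [i2, i1]
      · by_cases j2 : j ∈ I₂' <;> simp [i2, i1, j2]
        have n1 : j ∉ I₁' := by rw [hm1']; rw [hm2'] at j2; omega
        simp [n1]
  have rev1 : ∀ i : Fin (2 * n), i.rev ∈ I₁ ↔ i ∈ I₁' := fun i => by
    have := i.2
    rw [hm1, hm1', Fin.val_rev]
    omega
  have rev1' : ∀ i : Fin (2 * n), i.rev ∈ I₁' ↔ i ∈ I₁ := fun i => by
    rw [← rev1, Fin.rev_rev]
  have rev2 : ∀ i : Fin (2 * n), i.rev ∈ I₂ ↔ i ∈ I₂' := fun i => by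
    have := i.2
    rw [hm2, hm2', Fin.val_rev]
    omega
  have rev2' : ∀ i : Fin (2 * n), i.rev ∈ I₂' ↔ i ∈ I₂ := fun i => by
    rw [← rev2, Fin.rev_rev]
  have revK : ∀ i : Fin (2 * n), i.rev ∈ K ↔ i ∈ K' := fun i => by
    have := i.2
    rw [hmK, hmK', Fin.val_rev]
    omega
  have revK' : ∀ i : Fin (2 * n), i.rev ∈ K' ↔ i ∈ K := fun i => by
    rw [← revK, Fin.rev_rev]
  have reve : ∀ i, i ∈ I₁ → e.symm i.rev = (e i).rev := fun i hi => by
    ext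
    have := i.2
    rw [heK' _ ((rev1' i).2 hi), Fin.val_rev, Fin.val_rev, heK i hi]
    omega
  have reve' : ∀ i, i ∈ I₁' → e i.rev = (e.symm i).rev := fun i hi => by
    have h := reve i.rev ((rev1 i).2 hi)
    rw [Fin.rev_rev] at h
    rw [h, Fin.rev_rev]
  intro j i
  rw [hG j i, hG i.rev j.rev]
  simp only [rev1, rev1', rev2, rev2', revK, revK']
  by_cases i2 : i ∈ I₂
  · have n1 : i ∉ I₁ := by rw [hm1]; rw [hm2] at i2; omega
    have n2 : i ∉ K' := by rw [hmK']; rw [hm2] at i2; omega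
    have n3 : i ∉ I₁' := by rw [hm1']; rw [hm2] at i2; omega
    have n4 : i ∉ K := by rw [hmK]; rw [hm2] at i2; omega
    by_cases jK : j ∈ K
    · have m1 : j ∉ I₂' := by rw [hm2']; rw [hmK] at jK; omega
      have m2 : j ∉ I₁' := by rw [hm1']; rw [hmK] at jK; omega
      simp [i2, jK, m1, m2]
    · by_cases j1 : j ∈ I₁
      · have m1 : j ∉ I₂' := by rw [hm2']; rw [hm1] at j1; omega
        have m2 : j ∉ I₁' := by rw [hm1']; rw [hm1] at j1; omega
        have hs1 : halfSign n j = halfSign n (e j) := by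
          have := heK j j1
          rw [hm1] at j1
          rw [halfSign, halfSign, if_pos (by omega), if_pos (by omega)]
        simp only [i2, jK, j1, m1, m2, n1, and_false, and_true, if_false, if_true, false_and]
        rw [reve j j1, hs1]
        exact hsk _ _
      · by_cases j1' : j ∈ I₁'
        · have m1 : j ∉ I₂' := by rw [hm2']; rw [hm1'] at j1'; omega
          have m2 : i ≠ e.symm j := fun h => by
            have h1 := heK' j j1'
            rw [← h] at h1
            rw [hm1'] at j1'
            rw [hm2] at i2
            omega
          have m3 : i.rev ≠ (e.symm j).rev := fun h => m2 (Fin.rev_injective h)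
          simp [i2, jK, j1, j1', m1, m2, n1, n2, n3, reve' j j1', m3]
        · simp only [i2, jK, j1, j1', n1, n2, n3, and_false, if_false]
          exact hsk _ _
  · by_cases i1 : i ∈ I₁
    · have n2 : i ∉ K := by rw [hmK]; rw [hm1] at i1; omega
      have n3 : i ∉ I₁' := by rw [hm1']; rw [hm1] at i1; omega
      have n4 : i ∉ K' := by rw [hmK']; rw [hm1] at i1; omega
      by_cases j1' : j ∈ I₁'
      · have m1 : j ∉ I₂' := by rw [hm2']; rw [hm1'] at j1'; omega
        have m2 : j ≠ e i := fun h => by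
          have h1 := heK i i1
          rw [← h] at h1
          rw [hm1'] at j1'
          rw [hm1] at i1
          omega
        have m3 : i ≠ e.symm j := fun h => m2 (by rw [h, e.apply_symm_apply])
        have m4 : i.rev ≠ (e.symm j).rev := fun h => m3 (Fin.rev_injective h)
        simp [i2, i1, j1', m1, m2, reve' j j1', m4]
      · have m1 : j = e i ↔ j.rev = (e i).rev := Fin.rev_injective.eq_iff.symm
        simp only [i2, i1, j1', n3, n4, and_false, if_false, if_true, false_and, reve i i1, m1]
        split_ifs with h
        · have h1 : j.val = i.val + (c + d) := by
            rw [← heK i i1]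
            exact congrArg Fin.val (Fin.rev_injective h)
          rw [hm1] at i1
          rw [halfSign, halfSign, if_pos (by omega), if_pos (by omega)]
          norm_num
        · simp
    · by_cases j2 : j ∈ I₂'
      · have m1 : j ∉ I₁' := by rw [hm1']; rw [hm2'] at j2; omega
        by_cases iK : i ∈ K'
        · simp [i2, i1, j2, iK]
        · by_cases i1' : i ∈ I₁'
          · have hs1 : halfSign n i = halfSign n (e.symm i) := by
              have := heK' i i1'
              rw [hm1'] at i1'
              rw [halfSign, halfSign, if_neg (by omega), if_neg (by omega)]
            simp only [i2, i1, j2, iK, i1', and_false, and_true, if_false, if_true, false_and]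
            rw [reve' i i1', hs1]
            exact hsk _ _
          · simp only [i2, i1, j2, iK, i1', m1, and_false, if_false, false_and]
            exact hsk _ _
      · by_cases j1' : j ∈ I₁'
        · have m1 : i = e.symm j ↔ i.rev = (e.symm j).rev := Fin.rev_injective.eq_iff.symm
          simp only [i2, i1, j2, j1', if_false, if_true, false_and, reve' j j1', m1]
          split_ifs with h
          · have h1 : i.val = j.val - (c + d) := by
              rw [← heK' j j1']
              exact congrArg Fin.val (Fin.rev_injective h)
            rw [hm1'] at j1'
            rw [halfSign, halfSign, if_neg (by omega), if_neg (by omega)]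
            norm_num
          · simp
        · simp only [i2, i1, j2, j1', if_false, false_and]
          exact hsk _ _

/-- A Euclidean step performed by `NilFree.shift_block` at each end: both first blocks shrink by
their difference `c`. -/
theorem hasSkewForm_of_lt_two_mul {n c d s : ℕ} {a b : List ℕ}
    (hs : s + ((c + d) :: a).sum ≤ n) (hs' : s + ((2 * c + d) :: b).sum ≤ n)
    (h : HasSkewForm n (d :: a) ((c + d) :: b) (s + c)) :
    HasSkewForm n ((c + d) :: a) ((2 * c + d) :: b) s := by
  obtain ⟨F, hF, hsk⟩ := h
  rw [List.sum_cons] at hs hs'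
  have e1 : s + c + d = s + (c + d) := by omega
  have e2 : s + c + (c + d) = s + (2 * c + d) := by omega
  set I₁ : Set (Fin (2 * n)) := {i | s ≤ i.val ∧ i.val < s + c} with hI₁
  set I₂ : Set (Fin (2 * n)) := {i | s + c ≤ i.val ∧ i.val < s + (c + d)} with hI₂
  set K : Set (Fin (2 * n)) := {i | s + (c + d) ≤ i.val ∧ i.val < s + (2 * c + d)} with hK
  set I₁' : Set (Fin (2 * n)) := {i | 2 * n ≤ i.val + s + c ∧ i.val + s < 2 * n} with hI₁'
  set I₂' : Set (Fin (2 * n)) :=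
    {i | 2 * n ≤ i.val + s + (c + d) ∧ i.val + s + c < 2 * n} with hI₂'
  set K' : Set (Fin (2 * n)) :=
      {i | 2 * n ≤ i.val + s + (2 * c + d) ∧ i.val + s + (c + d) < 2 * n} with hK'
  have hb : ∀ i j : Fin (2 * n), MirrorBlock (2 * n) a (s + (c + d)) i j →
      s + (c + d) ≤ i.val ∧ i.val + (s + (c + d)) < 2 * n ∧ s + (c + d) ≤ j.val ∧
        j.val + (s + (c + d)) < 2 * n :=
    fun i j => MirrorBlock.bounds (by omega)
  have hb' : ∀ i j : Fin (2 * n), MirrorBlock (2 * n) b (s + (2 * c + d)) i j →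
      s + (2 * c + d) ≤ i.val ∧ i.val + (s + (2 * c + d)) < 2 * n ∧ s + (2 * c + d) ≤ j.val ∧
        j.val + (s + (2 * c + d)) < 2 * n :=
    fun i j => MirrorBlock.bounds (by omega)
  set e := shiftPerm (2 * n) (c + d) (by omega) with he
  have hm1 : ∀ i, i ∈ I₁ ↔ s ≤ i.val ∧ i.val < s + c := fun _ => Iff.rfl
  have hm2 : ∀ i, i ∈ I₂ ↔ s + c ≤ i.val ∧ i.val < s + (c + d) := fun _ => Iff.rfl
  have hmK : ∀ i, i ∈ K ↔ s + (c + d) ≤ i.val ∧ i.val < s + (2 * c + d) := fun _ => Iff.rfl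
  have hm1' : ∀ i, i ∈ I₁' ↔ 2 * n ≤ i.val + s + c ∧ i.val + s < 2 * n := fun _ => Iff.rfl
  have hm2' : ∀ i, i ∈ I₂' ↔ 2 * n ≤ i.val + s + (c + d) ∧ i.val + s + c < 2 * n :=
    fun _ => Iff.rfl
  have hmK' : ∀ i, i ∈ K' ↔ 2 * n ≤ i.val + s + (2 * c + d) ∧ i.val + s + (c + d) < 2 * n :=
      fun _ => Iff.rfl
  clear_value I₁ I₂ K I₁' I₂' K'
  set r : Fin (2 * n) → Fin (2 * n) → Prop :=
      mirrorRel n ((c + d) :: a) ((2 * c + d) :: b) s with hr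
  set r₂ := mirrorRel n (d :: a) ((c + d) :: b) (s + c) with hr₂
  set r₁ : Fin (2 * n) → Fin (2 * n) → Prop := fun i j => r i j ∧ i ∉ I₁ ∧ j ∉ I₁ with hr₁
  have hkey : ∀ i j : Fin (2 * n), ∃ p q : ℕ,
      (p = 1 → s + (c + d) ≤ i.val ∧ i.val + (s + (c + d)) < 2 * n ∧ s + (c + d) ≤ j.val ∧
        j.val + (s + (c + d)) < 2 * n) ∧
      (q = 1 → s + (2 * c + d) ≤ i.val ∧ i.val + (s + (2 * c + d)) < 2 * n ∧
        s + (2 * c + d) ≤ j.val ∧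
        j.val + (s + (2 * c + d)) < 2 * n) ∧
      (r i j ↔ (j.val ≤ i.val ∧ ((s ≤ i.val ∧ i.val < s + (c + d) ∧ s ≤ j.val ∧
        j.val < s + (c + d)) ∨
          (2 * n ≤ i.val + s + (c + d) ∧ i.val + s < 2 * n ∧ 2 * n ≤ j.val + s + (c + d) ∧
            j.val + s < 2 * n) ∨ p = 1)) ∨
        (i.val ≤ j.val ∧ ((s ≤ i.val ∧ i.val < s + (2 * c + d) ∧ s ≤ j.val ∧
          j.val < s + (2 * c + d)) ∨
          (2 * n ≤ i.val + s + (2 * c + d) ∧ i.val + s < 2 * n ∧ 2 * n ≤ j.val + s + (2 * c + d) ∧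
            j.val + s < 2 * n) ∨ q = 1))) ∧
      (r₂ i j ↔ (j.val ≤ i.val ∧ ((s + c ≤ i.val ∧ i.val < s + (c + d) ∧
            s + c ≤ j.val ∧ j.val < s + (c + d)) ∨
          (2 * n ≤ i.val + (s + c) + d ∧ i.val + (s + c) < 2 * n ∧
            2 * n ≤ j.val + (s + c) + d ∧ j.val + (s + c) < 2 * n) ∨
          p = 1)) ∨
        (i.val ≤ j.val ∧ ((s + c ≤ i.val ∧ i.val < s + (2 * c + d) ∧
            s + c ≤ j.val ∧ j.val < s + (2 * c + d)) ∨
          (2 * n ≤ i.val + (s + c) + (c + d) ∧ i.val + (s + c) < 2 * n ∧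
            2 * n ≤ j.val + (s + c) + (c + d) ∧ j.val + (s + c) < 2 * n) ∨
          q = 1))) := by
    intro i j
    obtain ⟨p, hp⟩ := exists_nat_eq_one_iff (MirrorBlock (2 * n) a (s + (c + d)) i j)
    obtain ⟨q, hq⟩ := exists_nat_eq_one_iff (MirrorBlock (2 * n) b (s + (2 * c + d)) i j)
    refine ⟨p, q, fun h => hb i j (hp.2 h), fun h => hb' i j (hq.2 h), ?_, ?_⟩
    · simp only [hr, mirrorRel, MirrorBlock, hp, hq]
    · simp only [hr₂, mirrorRel, MirrorBlock, hp, hq, e1, e2]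
  have hdis : ∀ A B : Set (Fin (2 * n)), (∀ i ∈ A, i ∉ B) → Disjoint A B := fun A B h =>
    Set.disjoint_left.2 h
  -- removal of the last block, seen in the transposed algebra
  have h1 : NilFree (fun j i => r₁ i j) (moveOn I₁' I₂' K' e.symm (-1) F.transpose) := by
    refine NilFree.shift_block (r' := fun j i => r₂ i j) (by norm_num) ?_ (hdis _ _ fun i => ?_)
      (hdis _ _ fun i => ?_) (hdis _ _ fun i => ?_) ?_ ?_ ?_ hF.transpose
    · intro i
      rw [hm1', hmK', he, val_shiftPerm_symm]
      have := i.2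
      split_ifs <;> omega
    · rw [hm1', hm2']
      omega
    · rw [hm1', hmK']
      omega
    · rw [hm2', hmK']
      omega
    · intro j hj i
      obtain ⟨p, q, h1, h2, h3, -⟩ := hkey i j
      simp only [hr₁, h3, hm1, hm1', hm2', hmK'] at *
      omega
    · intro j hj i
      obtain ⟨p, q, h1, h2, h3, -⟩ := hkey j i
      simp only [hr₁, h3, hm1, hm1', hm2'] at *
      omega
    · intro j i
      obtain ⟨p, q, h1, h2, h3, h4⟩ := hkey i j
      simp only [hr₁, h3, h4, hm1, hm1']
      omega
  have h2 : NilFree r (moveOn I₁ I₂ K e 1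
      (moveOn I₁' I₂' K' e.symm (-1) F.transpose).transpose) := by
    refine NilFree.shift_block (r' := r₁) one_ne_zero ?_ (hdis _ _ fun i => ?_)
      (hdis _ _ fun i => ?_) (hdis _ _ fun i => ?_) ?_ ?_ (fun _ _ => Iff.rfl) h1.transpose
    · intro i
      rw [hm1, hmK, he, val_shiftPerm]
      have := i.2
      split_ifs <;> omega
    · rw [hm1, hm2]
      omega
    · rw [hm1, hmK]
      omega
    · rw [hm2, hmK]
      omega
    · intro i hi j
      obtain ⟨p, q, h1, h2, h3, -⟩ := hkey i j
      simp only [h3, hm1, hm2, hmK] at *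
      omega
    · intro i hi j
      obtain ⟨p, q, h1, h2, h3, -⟩ := hkey j i
      simp only [h3, hm1, hm2] at *
      omega
  exact ⟨_, h2, isSkew_moveOn (by omega) hsk hm1 hm2 hmK hm1' hm2' hmK' he⟩

end Reductions

/-! ### The induction -/

section Existence

theorem hasSkewForm_congr {n : ℕ} {a b a' b' : List ℕ} {s : ℕ}
    (ha : ∀ i j, MirrorBlock (2 * n) a s i j ↔ MirrorBlock (2 * n) a' s i j)
    (hb : ∀ i j, MirrorBlock (2 * n) b s i j ↔ MirrorBlock (2 * n) b' s i j) :
    HasSkewForm n a b s ↔ HasSkewForm n a' b' s := by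
  unfold HasSkewForm mirrorRel
  simp only [ha, hb]

/-- Every palindromic seaweed has a skew one-form whose stabilizer has no nonzero nilpotents. -/
theorem hasSkewForm (n : ℕ) (a b : List ℕ) (s : ℕ) (hs : s + a.sum ≤ n) (hs' : s + b.sum ≤ n) :
    HasSkewForm n a b s := by
  -- Lengths are counted so that discarding a block of size 0 also lowers the measure.
  induction hm : a.sum + b.sum + a.length + b.length using Nat.strong_induction_on
    generalizing a b s with
  | _ m ih =>
    subst hm
    match a, b with
    | [], [] => exact hasSkewForm_nil_nil n s
    | a₁ :: a, [] =>
      refine hasSkewForm_cons_nil hs (ih _ ?_ a [] (s + a₁) ?_ ?_ rfl) <;>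
        simp only [List.sum_cons, List.sum_nil, List.length_cons, List.length_nil] at hs hs' ⊢ <;>
        omega
    | [], b₁ :: b =>
      refine (hasSkewForm_cons_nil hs' (ih _ ?_ b [] (s + b₁) ?_ ?_ rfl)).swap <;>
        simp only [List.sum_cons, List.sum_nil, List.length_cons, List.length_nil] at hs hs' ⊢ <;>
        omega
    | a₁ :: a, b₁ :: b =>
      have step : ∀ (a₁ b₁ : ℕ) (a b : List ℕ), a₁ < b₁ → s + (a₁ :: a).sum ≤ n →
          s + (b₁ :: b).sum ≤ n →
          (∀ m < (a₁ :: a).sum + (b₁ :: b).sum + (a₁ :: a).length + (b₁ :: b).length,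
            ∀ (a b : List ℕ) (s : ℕ), s + a.sum ≤ n → s + b.sum ≤ n →
              a.sum + b.sum + a.length + b.length = m → HasSkewForm n a b s) →
          HasSkewForm n (a₁ :: a) (b₁ :: b) s := by
        intro a₁ b₁ a b hlt hs hs' ih
        -- Empty blocks do arise, when the longer block is exactly twice the shorter; the pairing
        -- reduction would make no progress on them.
        rcases Nat.eq_zero_or_pos a₁ with rfl | hpos
        · rw [hasSkewForm_congr (fun _ _ => mirrorBlock_zero_cons) fun _ _ => Iff.rfl]
          refine ih _ ?_ a (b₁ :: b) s ?_ hs' rfl <;>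
            simp only [List.sum_cons, List.length_cons] at hs ⊢ <;> omega
        · rcases le_or_gt (2 * a₁) b₁ with h | h
          · obtain ⟨c, rfl⟩ := Nat.exists_eq_add_of_le h
            refine hasSkewForm_of_two_mul_le hs hs' (ih _ ?_ _ _ _ ?_ ?_ rfl) <;>
              simp only [List.sum_cons, List.length_cons] at hs hs' ⊢ <;> omega
          -- Here `c = b₁ - a₁` and `d = 2 * a₁ - b₁`.
          · obtain ⟨c, rfl⟩ := Nat.exists_eq_add_of_le hlt.le
            obtain ⟨d, rfl⟩ := Nat.exists_eq_add_of_le (show c ≤ a₁ by omega)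
            have he : c + d + c = 2 * c + d := by ring
            rw [he] at hs' ⊢
            refine hasSkewForm_of_lt_two_mul hs hs' (ih _ ?_ _ _ _ ?_ ?_ rfl) <;>
              simp only [List.sum_cons, List.length_cons] at hs hs' ⊢ <;> omega
      rcases lt_trichotomy a₁ b₁ with h | rfl | h
      · exact step a₁ b₁ a b h hs hs' fun m hm a b s h1 h2 h3 => ih m hm a b s h1 h2 h3
      · refine hasSkewForm_cons_cons_eq hs hs' (ih _ ?_ _ _ _ ?_ ?_ rfl) <;>
          simp only [List.sum_cons, List.length_cons] at hs hs' ⊢ <;> omega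
      · exact (step b₁ a₁ b a h hs' hs fun m hm a b s h1 h2 h3 =>
          ih m (by omega) a b s h1 h2 h3).swap

end Existence

/-! ### Comparing the two descriptions of blocks -/

section Blocks

theorem not_sameBlock_nil {i j : ℕ} : ¬ SameBlock [] i j := fun ⟨_, hk, _⟩ => by simp at hk

theorem sameBlock_cons {c : ℕ} {l : List ℕ} {i j : ℕ} : SameBlock (c :: l) i j ↔
    (i < c ∧ j < c) ∨ (c ≤ i ∧ c ≤ j ∧ SameBlock l (i - c) (j - c)) := by
  constructor
  · rintro ⟨k, hk, hi, hj⟩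
    cases k with
    | zero =>
      simp only [List.take_succ_cons, List.take_zero, List.sum_cons, List.sum_nil] at hi hj
      exact Or.inl ⟨by omega, by omega⟩
    | succ k =>
      simp only [List.take_succ_cons, List.sum_cons, List.length_cons] at hi hj hk
      exact Or.inr ⟨by omega, by omega, k, by omega, by omega, by omega⟩
  · rintro (⟨hi, hj⟩ | ⟨hi, hj, k, hk, hi', hj'⟩)
    · exact ⟨0, by simp, by simpa using hi, by simpa using hj⟩
    · refine ⟨k + 1, by simpa using hk, ?_, ?_⟩ <;>
        simp only [List.take_succ_cons, List.sum_cons] <;> omega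

theorem sameBlock_self {c : List ℕ} {i : ℕ} (hi : i < c.sum) : SameBlock c i i := by
  induction c generalizing i with
  | nil => exact absurd hi (by simp)
  | cons c l ih =>
    rw [List.sum_cons] at hi
    rw [sameBlock_cons]
    rcases lt_or_ge i c with h | h
    · exact Or.inl ⟨h, h⟩
    · exact Or.inr ⟨h, h, ih (by omega)⟩

theorem sameBlock_append {X Y : List ℕ} {i j : ℕ} : SameBlock (X ++ Y) i j ↔
    SameBlock X i j ∨ (X.sum ≤ i ∧ X.sum ≤ j ∧ SameBlock Y (i - X.sum) (j - X.sum)) := by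
  induction X generalizing i j with
  | nil => simp [not_sameBlock_nil]
  | cons c X ih =>
    rw [List.cons_append, sameBlock_cons, sameBlock_cons, ih, List.sum_cons, Nat.sub_sub,
      Nat.sub_sub]
    by_cases h : SameBlock Y (i - (c + X.sum)) (j - (c + X.sum)) <;>
      by_cases h' : SameBlock X (i - c) (j - c) <;>
      simp only [h, h', and_true, and_false, or_false, true_or, false_or] <;> omega

theorem sameBlock_singleton {c i j : ℕ} : SameBlock [c] i j ↔ i < c ∧ j < c := by
  rw [sameBlock_cons]
  simp [not_sameBlock_nil]

/-- Peeling one block from each end of the list turns the prefix-sum description into the recursive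
one on which the reduction works. -/
theorem sameBlock_palindrome {n : ℕ} {c : List ℕ} {s i j : ℕ} (hs : s + c.sum ≤ n) :
    SameBlock (c ++ [2 * (n - s - c.sum)] ++ c.reverse) i j ↔
      MirrorBlock (2 * n) c s (i + s) (j + s) := by
  induction c generalizing s i j with
  | nil =>
    simp only [List.nil_append, List.reverse_nil, List.append_nil, List.sum_nil,
      sameBlock_singleton, MirrorBlock] at hs ⊢
    omega
  | cons c l ih =>
    rw [List.sum_cons] at hs
    have h0 : c :: l ++ [2 * (n - s - (c :: l).sum)] ++ (c :: l).reverse =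
        c :: ((l ++ [2 * (n - (s + c) - l.sum)] ++ l.reverse) ++ [c]) := by
      rw [List.sum_cons, List.reverse_cons, ← Nat.sub_sub, ← Nat.sub_sub]
      simp
    rw [h0, sameBlock_cons, sameBlock_append, sameBlock_singleton, ih (by omega)]
    simp only [List.sum_append, List.sum_cons, List.sum_nil, List.sum_reverse, MirrorBlock]
    have key : c ≤ i → c ≤ j → (MirrorBlock (2 * n) l (s + c) (i - c + (s + c)) (j - c + (s + c)) ↔
        MirrorBlock (2 * n) l (s + c) (i + s) (j + s)) := fun h1 h2 => by
      rw [show i - c + (s + c) = i + s by omega, show j - c + (s + c) = j + s by omega]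
    have hb : MirrorBlock (2 * n) l (s + c) (i + s) (j + s) → _ := MirrorBlock.bounds (by omega)
    by_cases h1 : c ≤ i ∧ c ≤ j
    · rw [key h1.1 h1.2]
      by_cases hp : MirrorBlock (2 * n) l (s + c) (i + s) (j + s)
      · simp only [hp, true_or, or_true, and_true]
        exact iff_of_true (Or.inr h1) trivial
      · simp only [hp, false_or, or_false]
        omega
    · have hp : ¬ MirrorBlock (2 * n) l (s + c) (i + s) (j + s) := fun h => by
        have := hb h
        omega
      simp only [hp, or_false]
      omega

theorem sameBlock_double {n : ℕ} (a : PartialComposition n) {i j : ℕ} :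
    SameBlock a.double i j ↔ MirrorBlock (2 * n) a.blocks 0 i j :=
  sameBlock_palindrome (s := 0) (by simpa using a.sum_le)

/-- A composition of `n` is the first half of a palindrome with empty central block. -/
theorem sameBlock_iff_mirrorBlock {n : ℕ} {c : List ℕ} (hc : c.sum = n) {i j : ℕ} (hi : i < n) :
    SameBlock c i j ↔ MirrorBlock (2 * n) c 0 i j := by
  rw [← add_zero i, ← add_zero j, ← sameBlock_palindrome (by omega), List.append_assoc,
    sameBlock_append]
  simp only [add_zero]
  exact ⟨Or.inl, fun h => h.elim id fun h => by omega⟩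

/-- With an empty central block nothing crosses the middle, so the first `n` positions are a union
of components. -/
theorem MirrorBlock.lt_iff {n : ℕ} {c : List ℕ} {s i j : ℕ} (hs : s + c.sum = n)
    (h : MirrorBlock (2 * n) c s i j) : i < n ↔ j < n := by
  induction c generalizing s with
  | nil =>
    simp only [List.sum_nil, MirrorBlock] at hs h
    omega
  | cons c l ih =>
    rw [List.sum_cons] at hs
    rcases h with h | h | h
    · omega
    · omega
    · exact ih (by omega) h

theorem MirrorBlock.rev {n : ℕ} {c : List ℕ} {s : ℕ} {i j : Fin (2 * n)}
    (h : MirrorBlock (2 * n) c s i j) : MirrorBlock (2 * n) c s i.rev j.rev := by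
  have hi := i.2
  have hj := j.2
  induction c generalizing s with
  | nil =>
    simp only [MirrorBlock, Fin.val_rev] at h ⊢
    omega
  | cons c l ih =>
    rcases h with h | h | h
    · refine Or.inr (Or.inl ?_)
      simp only [Fin.val_rev]
      omega
    · refine Or.inl ?_
      simp only [Fin.val_rev]
      omega
    · exact Or.inr (Or.inr (ih h))

theorem mirrorRel.rev {n : ℕ} {a b : List ℕ} {s : ℕ} {i j : Fin (2 * n)}
    (h : mirrorRel n a b s i j) : mirrorRel n a b s j.rev i.rev := by
  rcases h with ⟨h, h'⟩ | ⟨h, h'⟩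
  · exact Or.inl ⟨Fin.rev_le_rev.2 h, h'.symm.rev⟩
  · exact Or.inr ⟨Fin.rev_le_rev.2 h, h'.symm.rev⟩

end Blocks

/-! ### Restriction to a union of components -/

section Restriction

/-- Extension of a matrix by zero along a map of index sets. -/
noncomputable def extendMatrix {κ ι : Type*} (f : κ → ι) (x : Matrix κ κ ℂ) : Matrix ι ι ℂ :=
  Function.extend f (fun a => Function.extend f (x a) 0) 0

variable {κ ι : Type*} {f : κ → ι}

theorem extendMatrix_apply (hf : Function.Injective f) (x : Matrix κ κ ℂ) (a b : κ) :
    extendMatrix f x (f a) (f b) = x a b := by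
  rw [extendMatrix, hf.extend_apply, hf.extend_apply]

theorem extendMatrix_of_notMem_left (x : Matrix κ κ ℂ) {i : ι} (hi : i ∉ Set.range f) (j : ι) :
    extendMatrix f x i j = 0 := by
  rw [extendMatrix, Function.extend_apply' _ _ _ hi]
  rfl

theorem extendMatrix_of_notMem_right (hf : Function.Injective f) (x : Matrix κ κ ℂ) (i : ι) {j : ι}
    (hj : j ∉ Set.range f) : extendMatrix f x i j = 0 := by
  by_cases hi : i ∈ Set.range f
  · obtain ⟨a, rfl⟩ := hi
    rw [extendMatrix, hf.extend_apply, Function.extend_apply' _ _ _ hj]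
    rfl
  · exact extendMatrix_of_notMem_left x hi j

variable [Fintype κ] [Fintype ι]

theorem extendMatrix_mul (hf : Function.Injective f) (x y : Matrix κ κ ℂ) :
    extendMatrix f (x * y) = extendMatrix f x * extendMatrix f y := by
  ext i j
  rw [Matrix.mul_apply]
  by_cases hi : i ∈ Set.range f
  · by_cases hj : j ∈ Set.range f
    · obtain ⟨a, rfl⟩ := hi
      obtain ⟨b, rfl⟩ := hj
      rw [extendMatrix_apply hf, Matrix.mul_apply]
      refine Fintype.sum_of_injective f hf _ _ (fun k hk => ?_) fun k => ?_
      · rw [extendMatrix_of_notMem_left y hk, mul_zero]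
      · rw [extendMatrix_apply hf, extendMatrix_apply hf]
    · rw [extendMatrix_of_notMem_right hf _ _ hj]
      exact (Finset.sum_eq_zero fun k _ => by
        rw [extendMatrix_of_notMem_right hf y _ hj, mul_zero]).symm
  · rw [extendMatrix_of_notMem_left _ hi]
    exact (Finset.sum_eq_zero fun k _ => by
      rw [extendMatrix_of_notMem_left x hi, zero_mul]).symm

theorem isNilpotent_extendMatrix [DecidableEq κ] [DecidableEq ι] (hf : Function.Injective f)
    {x : Matrix κ κ ℂ} (hx : IsNilpotent x) : IsNilpotent (extendMatrix f x) := by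
  obtain ⟨k, hk⟩ := hx
  have hp : ∀ m : ℕ, extendMatrix f x ^ (m + 1) = extendMatrix f (x ^ (m + 1)) := fun m => by
    induction m with
    | zero => rw [zero_add, pow_one, pow_one]
    | succ m ih => rw [pow_succ, ih, ← extendMatrix_mul hf, ← pow_succ]
  refine ⟨k + 1, ?_⟩
  rw [hp, pow_succ, hk, zero_mul]
  ext i j
  by_cases hi : i ∈ Set.range f
  · by_cases hj : j ∈ Set.range f
    · obtain ⟨a, rfl⟩ := hi
      obtain ⟨b, rfl⟩ := hj
      exact extendMatrix_apply hf _ _ _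
    · exact extendMatrix_of_notMem_right hf _ _ hj
  · exact extendMatrix_of_notMem_left _ hi _

/-- One-forms without nilpotent stabilizers restrict to unions of connected components. -/
theorem NilFree.comap [DecidableEq κ] [DecidableEq ι] {r : ι → ι → Prop} {F : Matrix ι ι ℂ}
    (hF : NilFree r F) (hf : Function.Injective f)
    (hr : ∀ i j, r i j → (i ∈ Set.range f ↔ j ∈ Set.range f)) :
    NilFree (fun a b => r (f a) (f b)) (F.submatrix f f) := by
  refine ⟨fun a b h => hF.supp _ _ h, fun x hx hc hn => ?_⟩
  have hs : ∀ i j, ¬ r i j → extendMatrix f x i j = 0 := fun i j hij => by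
    by_cases hi : i ∈ Set.range f
    · by_cases hj : j ∈ Set.range f
      · obtain ⟨a, rfl⟩ := hi
        obtain ⟨b, rfl⟩ := hj
        rw [extendMatrix_apply hf]
        exact hx a b hij
      · exact extendMatrix_of_notMem_right hf x i hj
    · exact extendMatrix_of_notMem_left x hi j
  have h0 : extendMatrix f x = 0 := by
    refine hF.eq_zero _ hs (fun i j hij => ?_) (isNilpotent_extendMatrix hf hn)
    rw [Matrix.mul_apply, Matrix.mul_apply]
    by_cases hi : i ∈ Set.range f
    · have hj := (hr i j hij).1 hi
      obtain ⟨a, rfl⟩ := hi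
      obtain ⟨b, rfl⟩ := hj
      have h := hc a b hij
      rw [Matrix.mul_apply, Matrix.mul_apply] at h
      refine Eq.trans (Eq.symm ?_) (h.trans ?_)
      · refine Fintype.sum_of_injective f hf _ _ (fun k hk => ?_) fun k => ?_
        · rw [extendMatrix_of_notMem_left x hk, mul_zero]
        · rw [extendMatrix_apply hf, Matrix.submatrix_apply]
      · refine Fintype.sum_of_injective f hf _ _ (fun k hk => ?_) fun k => ?_
        · rw [extendMatrix_of_notMem_right hf x _ hk, zero_mul]
        · rw [extendMatrix_apply hf, Matrix.submatrix_apply]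
    · have hj : j ∉ Set.range f := fun h => hi ((hr i j hij).2 h)
      rw [Finset.sum_eq_zero fun k _ => by
          rw [extendMatrix_of_notMem_right hf x k hi, mul_zero],
        Finset.sum_eq_zero fun k _ => by
          rw [extendMatrix_of_notMem_left x hj k, zero_mul]]
  ext a b
  rw [← extendMatrix_apply hf x a b, h0]
  rfl

end Restriction

/-! ### Trace forms and type A -/

section TraceForm

/-- The one-form `y ↦ tr (F y)` on a Lie algebra of matrices. -/
noncomputable def traceForm {N : ℕ} (g : LieSubalgebra ℂ (Matrix (Fin N) (Fin N) ℂ))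
    (F : Matrix (Fin N) (Fin N) ℂ) : Module.Dual ℂ g :=
  (Matrix.traceLinearMap (Fin N) ℂ ℂ ∘ₗ LinearMap.mulLeft ℂ F) ∘ₗ g.toSubmodule.subtype

theorem traceForm_lie {N : ℕ} {g : LieSubalgebra ℂ (Matrix (Fin N) (Fin N) ℂ)}
    (F : Matrix (Fin N) (Fin N) ℂ) (x y : g) :
    traceForm g F ⁅x, y⁆ = ((F * x.val - x.val * F) * y.val).trace := by
  change (F * (⁅x, y⁆ : g).val).trace = _
  rw [LieSubalgebra.coe_bracket, Ring.lie_def, mul_sub, sub_mul, Matrix.trace_sub,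
    Matrix.trace_sub, ← mul_assoc, ← mul_assoc, Matrix.trace_mul_cycle F y.val x.val]

theorem trace_mul_single_one {N : ℕ} (M : Matrix (Fin N) (Fin N) ℂ) (i j : Fin N) :
    (M * Matrix.single i j 1).trace = M j i := by
  rw [Matrix.trace_mul_single]
  simp

theorem single_mem_seaweedSpace {N : ℕ} {a b : List ℕ} {i j : Fin N} (h : Admissible a b i j)
    (c : ℂ) : Matrix.single i j c ∈ seaweedSpace N a b := by
  rw [mem_seaweedSpace]
  intro k l hkl
  rw [Matrix.single_apply, if_neg]
  rintro ⟨rfl, rfl⟩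
  exact hkl h

/-- Seaweed algebras of type A are contact as soon as the index equals one. -/
theorem isContact_typeA {n : ℕ} (a b : Composition n) (h : lieIndex (typeA a b) = 1) :
    IsContact (typeA a b) := by
  -- The seaweed is the upper left corner of a palindromic one in `gl(2n)`; skewness plays no role
  -- here.
  obtain ⟨F₀, hF₀, -⟩ := hasSkewForm n a.blocks b.blocks 0 (by simp [a.blocks_sum])
    (by simp [b.blocks_sum])
  have hle : n ≤ 2 * n := by omega
  have hrange : ∀ i : Fin (2 * n), i ∈ Set.range (Fin.castLE hle) ↔ i.val < n := fun i =>
    ⟨fun ⟨k, hk⟩ => hk ▸ k.2, fun hi => ⟨⟨i, hi⟩, rfl⟩⟩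
  have hF := hF₀.comap (Fin.castLE_injective hle) fun i j hij => by
    rw [hrange, hrange]
    exact hij.elim (fun h => h.2.lt_iff (by simp [a.blocks_sum]))
      fun h => h.2.lt_iff (by simp [b.blocks_sum])
  have hr : ∀ i j : Fin n, mirrorRel n a.blocks b.blocks 0 (i.castLE hle) (j.castLE hle) ↔
      Admissible a.blocks b.blocks i j := fun i j => by
    rw [Admissible, sameBlock_iff_mirrorBlock a.blocks_sum i.2,
      sameBlock_iff_mirrorBlock b.blocks_sum i.2]
    rfl
  simp only [hr] at hF
  set F := F₀.submatrix (Fin.castLE hle) (Fin.castLE hle)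
  refine isContact_of_lieIndex_eq_one _ (traceForm _ F) (fun x hx hn => ?_) h
  rw [mem_ker_kirillovForm] at hx
  have hone : (1 : Matrix (Fin n) (Fin n) ℂ) ∈ seaweedSpace n a.blocks b.blocks := by
    rw [mem_seaweedSpace]
    intro i j hij
    rw [Matrix.one_apply, if_neg]
    rintro rfl
    exact hij (Or.inl ⟨le_rfl, sameBlock_self (by rw [a.blocks_sum]; exact i.2)⟩)
  have key : ∀ y ∈ seaweedSpace n a.blocks b.blocks,
      ((F * x.val - x.val * F) * y).trace = 0 := by
    intro y hy
    have hn0 : n = 0 ∨ (n : ℂ) ≠ 0 := by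
      rcases Nat.eq_zero_or_pos n with h | h
      · exact Or.inl h
      · exact Or.inr (Nat.cast_ne_zero.2 h.ne')
    rcases hn0 with rfl | hn0
    · simp [Matrix.trace]
    -- The identity lies in the `gl` seaweed and pairs to zero with any commutator, so traceless
    -- test matrices suffice.
    · have hy0 : y - (y.trace / n) • (1 : Matrix (Fin n) (Fin n) ℂ) ∈ typeA a b := by
        refine ⟨Submodule.sub_mem _ hy (Submodule.smul_mem _ _ hone), ?_⟩
        change Matrix.trace (n := Fin n) _ = 0
        rw [Matrix.trace_sub, Matrix.trace_smul, Matrix.trace_one,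
          Fintype.card_fin, smul_eq_mul, div_mul_cancel₀ _ hn0, sub_self]
      have h1 := hx ⟨_, hy0⟩
      rw [traceForm_lie] at h1
      simp only [mul_sub, mul_smul_comm, mul_one, Matrix.trace_sub, Matrix.trace_smul] at h1
      rw [Matrix.trace_mul_comm F, sub_self, smul_zero, sub_zero] at h1
      exact h1
  refine Subtype.ext (hF.eq_zero _ (mem_seaweedSpace.1 x.2.1) (fun i j hij => ?_) hn)
  have h1 := key _ (single_mem_seaweedSpace hij 1)
  rw [trace_mul_single_one, Matrix.sub_apply] at h1
  exact sub_eq_zero.1 h1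

end TraceForm

/-! ### Skew matrices and type C -/

section Symplectic

theorem halfSign_mul_self {n : ℕ} (i : Fin (2 * n)) : halfSign n i * halfSign n i = 1 := by
  unfold halfSign
  split_ifs <;> norm_num

theorem halfSign_rev {n : ℕ} (i : Fin (2 * n)) : halfSign n i.rev = - halfSign n i := by
  have := i.2
  unfold halfSign
  rw [Fin.val_rev]
  split_ifs <;> first | omega | norm_num

theorem antiJ_apply {n : ℕ} (i j : Fin (2 * n)) :
    antiJ n i j = if j = i.rev then halfSign n i else 0 := rfl

theorem mem_sp_iff {n : ℕ} {M : Matrix (Fin (2 * n)) (Fin (2 * n)) ℂ} : M ∈ sp n ↔ IsSkew M := by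
  rw [sp, mem_skewAdjointMatricesLieSubalgebra, mem_skewAdjointMatricesSubmodule,
    Matrix.IsSkewAdjoint, Matrix.IsAdjointPair, ← Matrix.ext_iff]
  have h1 : ∀ k l, (M.transpose * antiJ n) k l = M l.rev k * halfSign n l.rev := fun k l => by
    rw [Matrix.mul_apply, Finset.sum_eq_single l.rev]
    · rw [antiJ_apply, if_pos (Fin.rev_rev l).symm, Matrix.transpose_apply]
    · intro m _ hm
      rw [antiJ_apply, if_neg fun h => hm (by rw [h, Fin.rev_rev]), mul_zero]
    · simp
  have h2 : ∀ k l, (antiJ n * -M) k l = - (halfSign n k * M k.rev l) := fun k l => by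
    rw [Matrix.mul_apply, Finset.sum_eq_single k.rev]
    · rw [antiJ_apply, if_pos rfl, Matrix.neg_apply, mul_neg]
    · intro m _ hm
      rw [antiJ_apply, if_neg hm, zero_mul]
    · simp
  simp only [h1, h2]
  constructor
  · intro h i j
    have := h i.rev j
    rw [Fin.rev_rev, halfSign_rev, halfSign_rev] at this
    linear_combination (M i j * -1) * halfSign_mul_self i - halfSign n i * this
  · intro h k l
    have := h k.rev l
    rw [Fin.rev_rev, halfSign_rev] at this
    rw [halfSign_rev, this]
    linear_combination (halfSign n l * M l.rev k) * halfSign_mul_self k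

/-- Used with `A` the matrix of the one-form, which is skew but need not lie in the seaweed. -/
theorem IsSkew.commutator {n : ℕ} {A B : Matrix (Fin (2 * n)) (Fin (2 * n)) ℂ} (hA : IsSkew A)
    (hB : IsSkew B) : IsSkew (A * B - B * A) := by
  have key : ∀ {A B : Matrix (Fin (2 * n)) (Fin (2 * n)) ℂ}, IsSkew A → IsSkew B → ∀ i j,
      (A * B) i j = halfSign n i * halfSign n j * (B * A) j.rev i.rev := by
    intro A B hA hB i j
    rw [Matrix.mul_apply, Matrix.mul_apply, Finset.mul_sum]
    refine Fintype.sum_equiv Fin.revPerm _ _ fun k => ?_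
    rw [hA i k, hB k j, Fin.revPerm_apply]
    linear_combination (halfSign n i * halfSign n j * A k.rev i.rev * B j.rev k.rev) *
      halfSign_mul_self k
  intro i j
  rw [Matrix.sub_apply, Matrix.sub_apply, key hA hB i j, key hB hA i j]
  ring

theorem isSkew_single_sub {n : ℕ} (i j : Fin (2 * n)) : IsSkew
    (Matrix.single i j 1 - Matrix.single j.rev i.rev (halfSign n i * halfSign n j)) := by
  intro k l
  simp only [Matrix.sub_apply, Matrix.single_apply]
  have e1 : (i = l.rev ∧ j = k.rev) ↔ (j.rev = k ∧ i.rev = l) := by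
    rw [Fin.rev_eq_iff, Fin.rev_eq_iff, and_comm]
  have e2 : (j.rev = l.rev ∧ i.rev = k.rev) ↔ (i = k ∧ j = l) := by
    rw [Fin.rev_inj, Fin.rev_inj, and_comm]
  rw [if_congr e1 rfl rfl, if_congr e2 rfl rfl]
  have h3 : (halfSign n k * halfSign n l) * (halfSign n k * halfSign n l) = 1 := by
    linear_combination (halfSign n l * halfSign n l) * halfSign_mul_self k + halfSign_mul_self l
  have h4 : i = k ∧ j = l → halfSign n i * halfSign n j = halfSign n k * halfSign n l :=
    fun h => by rw [h.1, h.2]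
  have h5 : j.rev = k ∧ i.rev = l → halfSign n i * halfSign n j = halfSign n k * halfSign n l :=
    fun h => by
      rw [← h.1, ← h.2, halfSign_rev, halfSign_rev]
      ring
  split_ifs with h1 h2 h2
  · rw [h4 h1]
    linear_combination -h3
  · rw [h4 h1]
    linear_combination -h3
  · rw [h5 h2]
    ring
  · ring

/-- Seaweed algebras of type C are contact as soon as the index equals one. -/
theorem isContact_typeC {n : ℕ} (a b : PartialComposition n) (h : lieIndex (typeC a b) = 1) :
    IsContact (typeC a b) := by
  obtain ⟨F, hF, hsk⟩ := hasSkewForm n a.blocks b.blocks 0 (by simpa using a.sum_le)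
    (by simpa using b.sum_le)
  have hr : ∀ i j : Fin (2 * n), mirrorRel n a.blocks b.blocks 0 i j ↔
      Admissible a.double b.double i j := fun i j => by
    rw [Admissible, sameBlock_double, sameBlock_double]
    rfl
  refine isContact_of_lieIndex_eq_one _ (traceForm _ F) (fun x hx hn => ?_) h
  rw [mem_ker_kirillovForm] at hx
  have hcomm : IsSkew (F * x.val - x.val * F) := hsk.commutator (mem_sp_iff.1 x.2.2)
  refine Subtype.ext (hF.eq_zero _ (fun i j hij => ?_) (fun i j hij => ?_) hn)
  · rw [hr] at hij
    exact mem_seaweedSpace.1 x.2.1 i j hij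
  -- Twice the projection of a matrix unit to `sp(2n)`; it stays in the seaweed because the support
  -- is stable under reversal.
  · have hy : Matrix.single i j 1 - Matrix.single j.rev i.rev (halfSign n i * halfSign n j) ∈
        typeC a b :=
      ⟨Submodule.sub_mem _ (single_mem_seaweedSpace ((hr i j).1 hij) _)
        (single_mem_seaweedSpace ((hr _ _).1 hij.rev) _), mem_sp_iff.2 (isSkew_single_sub i j)⟩
    have h1 := hx ⟨_, hy⟩
    rw [traceForm_lie, mul_sub, Matrix.trace_sub, trace_mul_single_one, Matrix.trace_mul_single]
      at h1
    have h2 := hcomm j i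
    simp only [MulOpposite.smul_eq_mul_unop, MulOpposite.unop_op] at h1
    -- By skewness of the commutator the two trace terms coincide, so the test yields twice the
    -- entry.
    have h3 : (F * x.val - x.val * F) j i = 0 := by
      linear_combination h1 / 2 + h2 / 2
    exact sub_eq_zero.1 (by rwa [Matrix.sub_apply] at h3)

end Symplectic

end Seaweed

theorem theorem4p2 :
    (∀ (n : ℕ) (a b : Composition n),
      Seaweed.IsContact (Seaweed.typeA a b) ↔ Seaweed.lieIndex (Seaweed.typeA a b) = 1) ∧
    (∀ (n : ℕ) (a b : Seaweed.PartialComposition n),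
      Seaweed.IsContact (Seaweed.typeC a b) ↔ Seaweed.lieIndex (Seaweed.typeC a b) = 1) :=
  ⟨fun _ a b => ⟨Seaweed.IsContact.lieIndex_eq_one, Seaweed.isContact_typeA a b⟩,
    fun _ a b => ⟨Seaweed.IsContact.lieIndex_eq_one, Seaweed.isContact_typeC a b⟩⟩
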